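/- Let $G$ be a complex Lie group and let $\Gamma\le G$ be a closed subgroup such that $X:=G/\Gamma$ is a complex manifold, i.e. carries a complex structure for which the projection $G\to G/\Gamma$ is a holomorphic submersion. Assume that $X$ is compact, connected and not reduced to a point. Then: (1) $X$ carries no SKT hyperbolic metric. Here a Hermitian metric, viewed as a $C^\infty$ positive definite $(1,1)$-form $\omega$ on $X$, is called SKT hyperbolic if $\partial\bar\partial\omega=0$ and, on the universal cover $\pi:\widetilde X\to X$, one has $\pi^*\omega=\partial\alpha+\bar\partial\beta$ for some $C^\infty$ complex-valued $1$-forms $\alpha,\beta$ on $\widetilde X$ that are bounded with respect to $\pi^*\omega$. (2) $X$ is not Kobayashi hyperbolic, i.e. its Kobayashi pseudodistance $d_X$ is not a distance. (3) For every $x\in X$ and every tangent vector $\xi\in T_xX$ there is a one-parameter complex subgroup of $G$, i.e. a holomorphic group homomorphism $\varphi:\mathbb C\to G$, such that the curve $t\mapsto \varphi(t)\cdot x$ in $X$ has derivative $\xi$ at $t=0$; the infinitesimal Kobayashi–Royden pseudometric of $X$ is identically zero; and $d_X(p,q)=0$ for all $p,q\in X$. -/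

import Mathlib

open scoped Manifold ContDiff

noncomputable section

namespace SKT

universe u v

/-! ### Complex differential forms on a complex vector space -/

section Vector

variable {F : Type v} [NormedAddCommGroup F] [NormedSpace ℂ F]

/-- Multiplication by `i`, as a real-linear endomorphism. -/
def J : F →L[ℝ] F := Complex.I • ContinuousLinearMap.id ℝ F

/-- The operator `∂` on complex-valued `k`-forms on a complex vector space: antisymmetrize the
complex-linear part `v ↦ (Dη(v) - i Dη(iv)) / 2` of the derivative of `η`. In coordinates,
`∂η = ∑ j, dz_j ∧ ∂η/∂z_j`. -/
def vDel {k : ℕ} (η : F → F [⋀^Fin k]→L[ℝ] ℂ) (x : F) : F [⋀^Fin (k + 1)]→L[ℝ] ℂ :=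
  .alternatizeUncurryFin
    ((1 / 2 : ℂ) • (fderiv ℝ η x - Complex.I • (fderiv ℝ η x).comp J))

/-- The operator `∂̄` on complex-valued `k`-forms on a complex vector space: antisymmetrize the
complex-antilinear part `v ↦ (Dη(v) + i Dη(iv)) / 2` of the derivative of `η`. In coordinates,
`∂̄η = ∑ j, dz̄_j ∧ ∂η/∂z̄_j`. -/
def vDelbar {k : ℕ} (η : F → F [⋀^Fin k]→L[ℝ] ℂ) (x : F) : F [⋀^Fin (k + 1)]→L[ℝ] ℂ :=
  .alternatizeUncurryFin
    ((1 / 2 : ℂ) • (fderiv ℝ η x + Complex.I • (fderiv ℝ η x).comp J))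

end Vector

/-! ### Complex differential forms on a complex manifold -/

section Forms

variable {F : Type v} [NormedAddCommGroup F] [NormedSpace ℂ F]

/-- Complex-valued differential forms of degree `k` (not necessarily smooth) on a complex manifold
`X` modelled on `F`; the tangent spaces are regarded as real vector spaces. -/
abbrev Form (F : Type v) [NormedAddCommGroup F] [NormedSpace ℂ F]
    (X : Type u) [TopologicalSpace X] [ChartedSpace F X] (k : ℕ) : Type (max u v) :=
  ∀ x : X, TangentSpace 𝓘(ℂ, F) x [⋀^Fin k]→L[ℝ] ℂ

variable {X : Type u} [TopologicalSpace X] [ChartedSpace F X]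
variable {Y : Type u} [TopologicalSpace Y] [ChartedSpace F Y]

/-- Pullback of a form along a holomorphic map. -/
def Form.pullback {k : ℕ} (f : Y → X) (η : Form F X k) : Form F Y k := fun y =>
  (η (f y)).compContinuousLinearMap ((mfderiv 𝓘(ℂ, F) 𝓘(ℂ, F) f y).restrictScalars ℝ)

/-- The expression of a form in the preferred holomorphic chart at `x₀`, i.e. its pullback along the
inverse of the chart; it is meaningful on the target of the chart. -/
def Form.inChart {k : ℕ} (η : Form F X k) (x₀ : X) : F → F [⋀^Fin k]→L[ℝ] ℂ := fun z =>
  (η ((extChartAt 𝓘(ℂ, F) x₀).symm z)).compContinuousLinearMap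
    ((mfderiv 𝓘(ℂ, F) 𝓘(ℂ, F) (extChartAt 𝓘(ℂ, F) x₀).symm z).restrictScalars ℝ :
      TangentSpace 𝓘(ℂ, F) z →L[ℝ] TangentSpace 𝓘(ℂ, F) ((extChartAt 𝓘(ℂ, F) x₀).symm z))

/-- Smooth (`C^∞` in the real sense) forms. -/
def Form.IsSmooth {k : ℕ} (η : Form F X k) : Prop :=
  ∀ x₀ : X, ContDiffOn ℝ ∞ (η.inChart x₀) (extChartAt 𝓘(ℂ, F) x₀).target

/-- The operator `∂` on forms, computed in the preferred holomorphic chart at each point. -/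
def Form.del {k : ℕ} (η : Form F X k) : Form F X (k + 1) := fun x =>
  (vDel (η.inChart x) (extChartAt 𝓘(ℂ, F) x x)).compContinuousLinearMap
    ((mfderiv 𝓘(ℂ, F) 𝓘(ℂ, F) (extChartAt 𝓘(ℂ, F) x) x).restrictScalars ℝ)

/-- The operator `∂̄` on forms, computed in the preferred holomorphic chart at each point. -/
def Form.delbar {k : ℕ} (η : Form F X k) : Form F X (k + 1) := fun x =>
  (vDelbar (η.inChart x) (extChartAt 𝓘(ℂ, F) x x)).compContinuousLinearMap
    ((mfderiv 𝓘(ℂ, F) 𝓘(ℂ, F) (extChartAt 𝓘(ℂ, F) x) x).restrictScalars ℝ)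

/-- A Hermitian metric, as a smooth positive definite real `(1,1)`-form. A two-form is of type
`(1,1)` precisely when it is invariant under multiplication of both arguments by `i`. -/
structure IsHermitianMetric (h : Form F X 2) : Prop where
  smooth : h.IsSmooth
  type_one_one : ∀ (x : X) (v w : TangentSpace 𝓘(ℂ, F) x),
    h x ![Complex.I • v, Complex.I • w] = h x ![v, w]
  real : ∀ (x : X) (v w : TangentSpace 𝓘(ℂ, F) x), (h x ![v, w]).im = 0
  pos : ∀ (x : X) (v : TangentSpace 𝓘(ℂ, F) x), v ≠ 0 → 0 < (h x ![v, Complex.I • v]).re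

/-- The length `√(ω(v, iv))` of a tangent vector with respect to a Hermitian metric `ω`. -/
def hnorm (h : Form F X 2) {x : X} (v : TangentSpace 𝓘(ℂ, F) x) : ℝ :=
  Real.sqrt (h x ![v, Complex.I • v]).re

/-- A form `η` is bounded with respect to a Hermitian metric `h` if its pointwise norms are uniformly
bounded. -/
def Form.IsBounded {k : ℕ} (η : Form F X k) (h : Form F X 2) : Prop :=
  ∃ C : ℝ, ∀ (x : X) (v : Fin k → TangentSpace 𝓘(ℂ, F) x), ‖η x v‖ ≤ C * ∏ i, hnorm h (v i)

/-- `π : Y → X` is the universal cover of the complex manifold `X`: a surjective covering map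
with simply connected total space, which carries the lifted complex structure, that is, `π` is
locally biholomorphic. -/
structure IsUniversalCover (F : Type v) [NormedAddCommGroup F] [NormedSpace ℂ F]
    {X : Type u} [TopologicalSpace X] [ChartedSpace F X]
    {Y : Type u} [TopologicalSpace Y] [ChartedSpace F Y] (π : Y → X) : Prop where
  isManifold : IsManifold 𝓘(ℂ, F) ω Y
  simplyConnected : SimplyConnectedSpace Y
  isCoveringMap : IsCoveringMap π
  surjective : Function.Surjective π
  isLocalBiholomorphism : IsLocalDiffeomorph 𝓘(ℂ, F) 𝓘(ℂ, F) ω π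

/-- A `(k+1)`-form `φ` on `X` is `(∂+∂̄)`-tilde-bounded with respect to the Hermitian metric `h`
if on the universal cover `π : Y → X` one has `π^*φ = ∂α + ∂̄β` for smooth `k`-forms `α`, `β` that
are bounded with respect to `π^*h`. -/
def IsDelDelbarTildeBounded {k : ℕ} (h : Form F X 2) (φ : Form F X (k + 1)) : Prop :=
  ∃ (Y : Type u) (_ : TopologicalSpace Y) (_ : ChartedSpace F Y) (π : Y → X),
    IsUniversalCover F π ∧
    ∃ α β : Form F Y k, α.IsSmooth ∧ β.IsSmooth ∧
      α.IsBounded (h.pullback π) ∧ β.IsBounded (h.pullback π) ∧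
      φ.pullback π = α.del + β.delbar

/-- SKT hyperbolic Hermitian metrics `h`: `∂∂̄h = 0`, and `h` is `(∂+∂̄)`-tilde-bounded with respect
to itself. -/
structure IsSKTHyperbolicMetric (h : Form F X 2) : Prop where
  isHermitianMetric : IsHermitianMetric h
  skt : h.delbar.del = 0
  tildeBounded : IsDelDelbarTildeBounded h h

end Forms

/-! ### The Kobayashi and Kobayashi–Royden pseudometrics -/

section Kobayashi

/-- The Poincaré distance on the open unit disc (of curvature `-1`):
`log ((1 + r) / (1 - r))` with `r = |(a - b) / (1 - conj(b) a)|`. -/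
def poincareDist (a b : ℂ) : ℝ :=
  Real.log ((1 + ‖(a - b) / (1 - starRingEnd ℂ b * a)‖) /
    (1 - ‖(a - b) / (1 - starRingEnd ℂ b * a)‖))

variable (F : Type v) [NormedAddCommGroup F] [NormedSpace ℂ F]
variable {X : Type u} [TopologicalSpace X] [ChartedSpace F X]

/-- `f` restricts to a holomorphic map from the open unit disc to `X` (its values outside of the
disc are irrelevant). -/
def IsHolomorphicDisc (f : ℂ → X) : Prop :=
  MDifferentiableOn 𝓘(ℂ, ℂ) 𝓘(ℂ, F) f (Metric.ball 0 1)

/-- The infimum of the Poincaré distances `ρ(a, b)` over all holomorphic maps `f` of the unit disc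
to `X` with `f a = p` and `f b = q` (it is `∞` if there is none). -/
def discDist (p q : X) : ENNReal :=
  ⨅ (f : ℂ → X) (a : ℂ) (b : ℂ) (_ : IsHolomorphicDisc F f)
    (_ : a ∈ Metric.ball (0 : ℂ) 1) (_ : b ∈ Metric.ball (0 : ℂ) 1) (_ : f a = p) (_ : f b = q),
    ENNReal.ofReal (poincareDist a b)

/-- The Kobayashi pseudodistance: the infimum of the total lengths of chains of holomorphic discs
joining `p` to `q`. -/
def kobayashiDist (p q : X) : ENNReal :=
  ⨅ (n : ℕ) (c : ℕ → X) (_ : c 0 = p) (_ : c n = q),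
    ∑ i ∈ Finset.range n, discDist F (c i) (c (i + 1))

/-- `X` is Kobayashi hyperbolic if its Kobayashi pseudodistance is a distance. -/
def IsKobayashiHyperbolic (X : Type u) [TopologicalSpace X] [ChartedSpace F X] : Prop :=
  ∀ p q : X, kobayashiDist F p q = 0 → p = q

variable {F}

/-- The infinitesimal Kobayashi–Royden pseudometric: the infimum of `|a|` over all holomorphic maps
`f` of the unit disc to `X` and all `a ∈ ℂ` such that `f` maps the tangent vector `a` at `0` to
`ξ`. -/
def kobayashiRoyden (ξ : TangentBundle 𝓘(ℂ, F) X) : ENNReal :=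
  ⨅ (f : ℂ → X) (a : ℂ) (_ : IsHolomorphicDisc F f)
    (_ : (⟨f 0, mfderiv 𝓘(ℂ, ℂ) 𝓘(ℂ, F) f 0 a⟩ : TangentBundle 𝓘(ℂ, F) X) = ξ), ‖a‖ₑ

end Kobayashi

end SKT

end

/-! A homogeneous space is full of entire curves. A tangent vector at `gΓ` lifts to `G`;
right-translated to the identity, the lift generates a complex one-parameter subgroup `φ`, and `t ↦
φ t • p` is an entire curve with the given velocity (`exists_complex_oneParameter`,
`exists_oneParameter_orbit`). Rescaling an entire curve by `z ↦ R z` with `R → ∞` kills the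
Kobayashi–Royden length of its velocity and the distance between its points. The group elements that
move every point along chains of such curves contain an open subgroup, whose orbits in the connected
space `X` are clopen; hence `d_X = 0`.

An SKT hyperbolic metric, on the contrary, forbids nonconstant entire curves
(`mfderiv_entire_eq_zero`). Lift such a curve to `g : ℂ → Y` on the universal cover. Along `g`, the
identity `π^*ω = ∂α + ∂̄β` says that the conformal density `s² = |g'|²` is the divergence of a
vector field of size at most `C s`. Testing against `χ²` gives `∫ χ² s² ≤ 16 C² ∫ |dχ|²`
(`integral_cutoff_sq_le`). The plane is parabolic, so the right side can be made arbitrarily small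
with `χ = 1` on any given disc (`exists_cutoff_energy_le`), and `s = 0`. All tangent vectors of `X`
would then vanish, making `X` discrete and connected, hence a point. -/

open scoped Topology

/-! ### Real one-parameter subgroups as integral curves of left-invariant fields. -/

section RealOneParameter

variable {E : Type*} [NormedAddCommGroup E] [NormedSpace ℝ E]
  {G : Type*} [Group G] [TopologicalSpace G] [ChartedSpace E G]

/-- A homomorphism `ℝ → G` differentiable at `0` is an integral curve of the left-invariant vector
field given by its velocity at `0`. -/
theorem isMIntegralCurve_mulInvariantVectorField_of_hom [LieGroup 𝓘(ℝ, E) ∞ G] {γ : ℝ → G}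
    (hγ : ∀ s t, γ (s + t) = γ s * γ t) {v : E}
    (hv : HasMFDerivAt 𝓘(ℝ, ℝ) 𝓘(ℝ, E) γ 0 ((1 : ℝ →L[ℝ] ℝ).smulRight v)) :
    IsMIntegralCurve (I := 𝓘(ℝ, E)) γ
      (mulInvariantVectorField (I := 𝓘(ℝ, E)) (G := G) v) := by
  intro t
  have h0 : γ 0 = 1 := by simpa using hγ 0 0
  have hsub : HasMFDerivAt 𝓘(ℝ, ℝ) 𝓘(ℝ, ℝ) (fun s : ℝ => s - t) t
      (ContinuousLinearMap.id ℝ ℝ) :=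
    ((hasFDerivAt_id t).sub_const t).hasMFDerivAt
  have hL : MDifferentiableAt 𝓘(ℝ, E) 𝓘(ℝ, E) (fun g : G => γ t * g) (γ (t - t)) :=
    (contMDiff_mul_left (I := 𝓘(ℝ, E)) (n := ∞)).mdifferentiableAt (by simp)
  have hv' : HasMFDerivAt 𝓘(ℝ, ℝ) 𝓘(ℝ, E) γ (t - t) ((1 : ℝ →L[ℝ] ℝ).smulRight v) := by
    rw [sub_self]; exact hv
  -- Differentiate `γ s = γ t * γ (s - t)` at `s = t`.
  have h2 := hL.hasMFDerivAt.comp t (HasMFDerivAt.comp (g := γ) (f := fun s : ℝ => s - t) t hv' hsub)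
  have e : (fun g : G => γ t * g) ∘ γ ∘ (fun s : ℝ => s - t) = γ := by
    funext s
    simp [← hγ]
  rw [e] at h2
  have h3 : γ (t - t) = 1 := by simp [h0]
  refine h2.congr_mfderiv (ContinuousLinearMap.ext fun (c : ℝ) => ?_)
  change mfderiv 𝓘(ℝ, E) 𝓘(ℝ, E) (fun g : G => γ t * g) (γ (t - t)) (c • v) =
    c • mfderiv 𝓘(ℝ, E) 𝓘(ℝ, E) (fun g : G => γ t * g) 1 v
  rw [h3]
  exact map_smul _ c v

theorem contMDiff_one_mulInvariantVectorField [LieGroup 𝓘(ℝ, E) ∞ G] (v : E) :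
    haveI : IsManifold 𝓘(ℝ, E) 1 G := .of_le (n := ∞) (by simp)
    ContMDiff 𝓘(ℝ, E) 𝓘(ℝ, E).tangent 1
      (fun g : G => (⟨g, mulInvariantVectorField (I := 𝓘(ℝ, E)) (G := G) v g⟩ :
        TangentBundle 𝓘(ℝ, E) G)) := by
  have : LieGroup 𝓘(ℝ, E) (minSmoothness ℝ 3) G :=
    .of_le (n := ∞) (by simpa using WithTop.coe_le_coe.2 (le_top (a := (3 : ℕ∞))))
  have := contMDiff_mulInvariantVectorField (I := 𝓘(ℝ, E)) (G := G) v
  exact this.of_le (by simp)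

/-- Homomorphisms `ℝ → G` with the same velocity at `0` are equal. -/
theorem eq_of_hom_of_hasMFDerivAt_zero [T2Space G] [LieGroup 𝓘(ℝ, E) ∞ G] {γ γ' : ℝ → G}
    (hγ : ∀ s t, γ (s + t) = γ s * γ t) (hγ' : ∀ s t, γ' (s + t) = γ' s * γ' t) {v : E}
    (hv : HasMFDerivAt 𝓘(ℝ, ℝ) 𝓘(ℝ, E) γ 0 ((1 : ℝ →L[ℝ] ℝ).smulRight v))
    (hv' : HasMFDerivAt 𝓘(ℝ, ℝ) 𝓘(ℝ, E) γ' 0 ((1 : ℝ →L[ℝ] ℝ).smulRight v)) : γ = γ' := by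
  have : IsManifold 𝓘(ℝ, E) 1 G := .of_le (n := ∞) (by simp)
  have h0 : γ 0 = 1 := by simpa using hγ 0 0
  have h0' : γ' 0 = 1 := by simpa using hγ' 0 0
  exact isMIntegralCurve_Ioo_eq_of_contMDiff_boundaryless (t₀ := 0)
    (contMDiff_one_mulInvariantVectorField v)
    (isMIntegralCurve_mulInvariantVectorField_of_hom hγ hv)
    (isMIntegralCurve_mulInvariantVectorField_of_hom hγ' hv') (h0.trans h0'.symm)

theorem mfderiv_mul_left_mulInvariantVectorField [LieGroup 𝓘(ℝ, E) ∞ G] (v : E) (g h : G) :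
    mfderiv 𝓘(ℝ, E) 𝓘(ℝ, E) (fun x : G => g * x) h
      (mulInvariantVectorField (I := 𝓘(ℝ, E)) (G := G) v h) =
      mulInvariantVectorField (I := 𝓘(ℝ, E)) (G := G) v (g * h) := by
  have hd : ∀ a b : G, MDifferentiableAt 𝓘(ℝ, E) 𝓘(ℝ, E) (fun x : G => a * x) b := fun a b =>
    (contMDiff_mul_left (I := 𝓘(ℝ, E)) (n := ∞)).mdifferentiableAt (by simp)
  have e : (fun x : G => g * h * x) = (fun x : G => g * x) ∘ (fun x : G => h * x) := by
    funext x; simp [mul_assoc]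
  unfold mulInvariantVectorField
  rw [e, mfderiv_comp (I' := 𝓘(ℝ, E)) (1 : G) (hd _ _) (hd _ _), mul_one]
  rfl

/-- Left translates of integral curves of left-invariant fields are integral curves. -/
theorem IsMIntegralCurveOn.mul_left [LieGroup 𝓘(ℝ, E) ∞ G] {γ : ℝ → G} {v : E} {s : Set ℝ}
    (hγ : IsMIntegralCurveOn (I := 𝓘(ℝ, E)) γ
      (mulInvariantVectorField (I := 𝓘(ℝ, E)) (G := G) v) s) (g : G) :
    IsMIntegralCurveOn (I := 𝓘(ℝ, E)) (fun t => g * γ t)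
      (mulInvariantVectorField (I := 𝓘(ℝ, E)) (G := G) v) s := by
  intro t ht
  have hd : MDifferentiableAt 𝓘(ℝ, E) 𝓘(ℝ, E) (fun x : G => g * x) (γ t) :=
    (contMDiff_mul_left (I := 𝓘(ℝ, E)) (n := ∞)).mdifferentiableAt (by simp)
  have := hd.hasMFDerivAt.comp_hasMFDerivWithinAt t (hγ t ht)
  refine this.congr_mfderiv (ContinuousLinearMap.ext fun (c : ℝ) => ?_)
  change mfderiv 𝓘(ℝ, E) 𝓘(ℝ, E) (fun x : G => g * x) (γ t) (c • _) = c • _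
  rw [map_smul, mfderiv_mul_left_mulInvariantVectorField]

/-- Existence of real one-parameter subgroups. -/
theorem exists_real_oneParameter [CompleteSpace E] [T2Space G] [LieGroup 𝓘(ℝ, E) ∞ G] (v : E) :
    ∃ γ : ℝ → G, (∀ s t, γ (s + t) = γ s * γ t) ∧
      MDifferentiable 𝓘(ℝ, ℝ) 𝓘(ℝ, E) γ ∧
      HasMFDerivAt 𝓘(ℝ, ℝ) 𝓘(ℝ, E) γ 0 ((1 : ℝ →L[ℝ] ℝ).smulRight v) := by
  have : IsManifold 𝓘(ℝ, E) 1 G := .of_le (n := ∞) (by simp)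
  have hV := contMDiff_one_mulInvariantVectorField (G := G) v
  obtain ⟨γ₀, h0, hγ₀⟩ := exists_isMIntegralCurveAt_of_contMDiffAt_boundaryless (t₀ := 0)
    (hV.contMDiffAt (x := (1 : G)))
  obtain ⟨ε, hε, hγ₀⟩ := isMIntegralCurveAt_iff'.1 hγ₀
  rw [Real.ball_eq_Ioo, zero_sub, zero_add] at hγ₀
  -- Left translates of a single local curve start at every point and live on the same interval, so
  -- the existence time is uniform and the field is complete.
  obtain ⟨γ, h1, hγ⟩ := exists_isMIntegralCurve_of_isMIntegralCurveOn hV hε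
    (fun g => ⟨fun t => g * γ₀ t, by simp [h0], hγ₀.mul_left g⟩) 1
  refine ⟨γ, fun s t => ?_, fun t => (hγ t).mdifferentiableAt, ?_⟩
  -- For fixed `s`, both `γ (s + t)` and `γ s * γ t` are integral curves in `t` issuing from `γ s`.
  · have ha : IsMIntegralCurve (I := 𝓘(ℝ, E)) (fun t => γ s * γ t)
        (mulInvariantVectorField (I := 𝓘(ℝ, E)) (G := G) v) := by
      rw [isMIntegralCurve_iff_isMIntegralCurveOn] at hγ ⊢
      exact hγ.mul_left _
    have hb := hγ.comp_add s
    have := isMIntegralCurve_Ioo_eq_of_contMDiff_boundaryless (t₀ := 0) hV hb ha (by simp [h1])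
    simpa [add_comm] using congrFun this t
  · have := hγ 0
    rw [h1] at this
    refine this.congr_mfderiv (ContinuousLinearMap.ext fun (c : ℝ) => ?_)
    change c • mfderiv 𝓘(ℝ, E) 𝓘(ℝ, E) (fun x : G => 1 * x) 1 v = c • v
    have e : (fun x : G => 1 * x) = id := by funext x; simp
    rw [e, mfderiv_id]
    rfl

end RealOneParameter

/-! ### Passing between complex and real differentiability on manifolds. -/

section RestrictScalars

variable {E : Type*} [NormedAddCommGroup E] [NormedSpace ℂ E]
  {F : Type*} [NormedAddCommGroup F] [NormedSpace ℂ F]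
  {M : Type*} [TopologicalSpace M] [ChartedSpace E M]
  {N : Type*} [TopologicalSpace N] [ChartedSpace F N]

/-- A complex manifold is a smooth real manifold. -/
theorem IsManifold.real_of_complex [IsManifold 𝓘(ℂ, E) ω M] : IsManifold 𝓘(ℝ, E) ∞ M := by
  refine isManifold_of_contDiffOn 𝓘(ℝ, E) ∞ M fun e e' he he' => ?_
  have h := (contDiffGroupoid ω 𝓘(ℂ, E)).compatible he he'
  have h2 := (contDiffGroupoid ω 𝓘(ℂ, E)).mem_of_eqOnSource h (Setoid.refl _)
  rw [contDiffGroupoid, mem_groupoid_of_pregroupoid] at h2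
  have h3 : ContDiffOn ℂ ω (𝓘(ℂ, E) ∘ (e.symm ≫ₕ e') ∘ 𝓘(ℂ, E).symm)
    (𝓘(ℂ, E).symm ⁻¹' (e.symm ≫ₕ e').source ∩ Set.range 𝓘(ℂ, E)) := h2.1
  exact (h3.restrict_scalars ℝ).of_le (by simp)

theorem HasMFDerivAt.real_of_complex {f : M → N} {x : M} {f' : E →L[ℂ] F}
    (h : HasMFDerivAt 𝓘(ℂ, E) 𝓘(ℂ, F) f x f') :
    HasMFDerivAt 𝓘(ℝ, E) 𝓘(ℝ, F) f x (f'.restrictScalars ℝ) :=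
  ⟨h.1, HasFDerivWithinAt.restrictScalars ℝ h.2⟩

/-- A real derivative that happens to be complex linear is a complex derivative; holomorphy of
one-parameter subgroups is obtained this way. -/
theorem HasMFDerivAt.complex_of_real {f : M → N} {x : M} {f' : E →L[ℂ] F}
    (h : HasMFDerivAt 𝓘(ℝ, E) 𝓘(ℝ, F) f x (f'.restrictScalars ℝ)) :
    HasMFDerivAt 𝓘(ℂ, E) 𝓘(ℂ, F) f x f' := by
  refine ⟨h.1, ?_⟩
  have h2 : HasFDerivWithinAt _ (f'.restrictScalars ℝ) (Set.range (id : E → E)) _ := h.2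
  have h3 := h2.hasFDerivAt (by simp)
  have h4 := hasFDerivAt_of_restrictScalars ℝ h3 (f' := f') rfl
  exact h4.hasFDerivWithinAt

theorem ContMDiff.real_of_complex {f : M → N}
    (h : ContMDiff 𝓘(ℂ, E) 𝓘(ℂ, F) ω f) : ContMDiff 𝓘(ℝ, E) 𝓘(ℝ, F) ∞ f := by
  intro x
  have h1 := contMDiffAt_iff.1 (h x)
  refine contMDiffAt_iff.2 ⟨h1.1, ?_⟩
  exact (ContDiffWithinAt.restrict_scalars ℝ h1.2).of_le (by simp)

/-- A complex Lie group is a real Lie group. -/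
theorem LieGroup.real_of_complex {G : Type*} [Group G] [TopologicalSpace G] [ChartedSpace E G]
    [LieGroup 𝓘(ℂ, E) ω G] : LieGroup 𝓘(ℝ, E) ∞ G where
  toIsManifold := IsManifold.real_of_complex
  contMDiff_mul := by
    intro x
    have h1 := contMDiffAt_iff.1 (contMDiff_mul 𝓘(ℂ, E) ω (G := G) x)
    refine contMDiffAt_iff.2 ⟨h1.1, ?_⟩
    exact (ContDiffWithinAt.restrict_scalars ℝ h1.2).of_le (by simp)
  contMDiff_inv := (contMDiff_inv (I := 𝓘(ℂ, E)) (n := ω) (G := G)).real_of_complex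

end RestrictScalars

/-! ### Complex one-parameter subgroups. -/

section ComplexOneParameter

variable {E : Type*} [NormedAddCommGroup E] [NormedSpace ℂ E]
  {G : Type*} [Group G] [TopologicalSpace G] [ChartedSpace E G]

/-- Homomorphisms `ℝ → G` with velocities `v` and `i v` commute. -/
theorem commute_of_hom_of_hasMFDerivAt_zero [T2Space G] [LieGroup 𝓘(ℂ, E) ω G] {γ γ' : ℝ → G}
    (hγ : ∀ s t, γ (s + t) = γ s * γ t) (hγ' : ∀ s t, γ' (s + t) = γ' s * γ' t) {v : E}
    (hv : HasMFDerivAt 𝓘(ℝ, ℝ) 𝓘(ℝ, E) γ 0 ((1 : ℝ →L[ℝ] ℝ).smulRight v))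
    (hv' : HasMFDerivAt 𝓘(ℝ, ℝ) 𝓘(ℝ, E) γ' 0 ((1 : ℝ →L[ℝ] ℝ).smulRight (Complex.I • v)))
    (s t : ℝ) : γ s * γ' t = γ' t * γ s := by
  have : LieGroup 𝓘(ℝ, E) ∞ G := LieGroup.real_of_complex
  have h0 : γ 0 = 1 := by simpa using hγ 0 0
  have h0' : γ' 0 = 1 := by simpa using hγ' 0 0
  -- Conjugation by `γ s` is holomorphic, so its derivative `D` at `1` is complex linear. It fixes
  -- `v` because `γ` commutes with itself, hence it fixes `i v`, and uniqueness of one-parameter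
  -- subgroups gives `c ∘ γ' = γ'`. No Lie bracket is needed.
  let c : G → G := fun x => γ s * x * (γ s)⁻¹
  have hc : MDifferentiableAt 𝓘(ℂ, E) 𝓘(ℂ, E) c 1 := by
    have h1 : ContMDiff 𝓘(ℂ, E) 𝓘(ℂ, E) ω c :=
      (contMDiff_mul_right (a := (γ s)⁻¹)).comp (contMDiff_mul_left (a := γ s))
    exact h1.mdifferentiableAt (by simp)
  obtain ⟨D, hD⟩ : ∃ D : E →L[ℂ] E, HasMFDerivAt 𝓘(ℂ, E) 𝓘(ℂ, E) c 1 D := ⟨_, hc.hasMFDerivAt⟩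
  have hDr := hD.real_of_complex
  have comp : ∀ (δ : ℝ → G) (w : E), δ 0 = 1 →
      HasMFDerivAt 𝓘(ℝ, ℝ) 𝓘(ℝ, E) δ 0 ((1 : ℝ →L[ℝ] ℝ).smulRight w) →
      HasMFDerivAt 𝓘(ℝ, ℝ) 𝓘(ℝ, E) (c ∘ δ) 0 ((1 : ℝ →L[ℝ] ℝ).smulRight (D w)) := by
    intro δ w hδ hw
    have h1 : HasMFDerivAt 𝓘(ℝ, E) 𝓘(ℝ, E) c (δ 0) (D.restrictScalars ℝ) := by
      rw [hδ]; exact hDr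
    refine (h1.comp (0 : ℝ) hw).congr_mfderiv (ContinuousLinearMap.ext fun (a : ℝ) => ?_)
    exact map_smul (D.restrictScalars ℝ) a w
  have hDv : D v = v := by
    have e : c ∘ γ = γ := by
      funext t
      simp only [c, Function.comp_apply, ← hγ, add_comm s t]
      rw [hγ, mul_inv_cancel_right]
    have h1 := comp γ v h0 hv
    rw [e] at h1
    have h2 := hasMFDerivAt_unique h1 hv
    have h3 := congrArg (fun L : ℝ →L[ℝ] E => L 1) h2
    exact (one_smul ℝ (D v)).symm.trans (Eq.trans h3 (one_smul ℝ v))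
  have h1 := comp γ' _ h0' hv'
  rw [map_smul, hDv] at h1
  have h2 : c ∘ γ' = γ' := eq_of_hom_of_hasMFDerivAt_zero (fun a b => by simp [c, hγ']) hγ' h1 hv'
  have h3 := congrFun h2 t
  simp only [c, Function.comp_apply] at h3
  rw [mul_inv_eq_iff_eq_mul] at h3
  exact h3

/-- Existence of complex one-parameter subgroups. -/
theorem exists_complex_oneParameter [CompleteSpace E] [T2Space G] [LieGroup 𝓘(ℂ, E) ω G] (v : E) :
    ∃ φ : ℂ → G, MDifferentiable 𝓘(ℂ, ℂ) 𝓘(ℂ, E) φ ∧ (∀ s t, φ (s + t) = φ s * φ t) ∧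
      HasMFDerivAt 𝓘(ℂ, ℂ) 𝓘(ℂ, E) φ 0 ((1 : ℂ →L[ℂ] ℂ).smulRight v) := by
  have : LieGroup 𝓘(ℝ, E) ∞ G := LieGroup.real_of_complex
  obtain ⟨γ, hγ, hγd, hγ0⟩ := exists_real_oneParameter (G := G) v
  obtain ⟨γ', hγ', hγd', hγ0'⟩ := exists_real_oneParameter (G := G) (Complex.I • v)
  have h0 : γ 0 = 1 := by simpa using hγ 0 0
  have h0' : γ' 0 = 1 := by simpa using hγ' 0 0
  have hcomm := commute_of_hom_of_hasMFDerivAt_zero hγ hγ' hγ0 hγ0'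
  let φ : ℂ → G := fun z => γ z.re * γ' z.im
  have hφ : ∀ s t, φ (s + t) = φ s * φ t := by
    intro s t
    simp only [φ, Complex.add_re, Complex.add_im, hγ, hγ']
    rw [mul_assoc, mul_assoc, ← mul_assoc (γ t.re), hcomm t.re, mul_assoc]
  have hre : HasMFDerivAt 𝓘(ℝ, ℂ) 𝓘(ℝ, ℝ) (fun z : ℂ => z.re) 0 Complex.reCLM :=
    Complex.reCLM.hasFDerivAt.hasMFDerivAt
  have him : HasMFDerivAt 𝓘(ℝ, ℂ) 𝓘(ℝ, ℝ) (fun z : ℂ => z.im) 0 Complex.imCLM :=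
    Complex.imCLM.hasFDerivAt.hasMFDerivAt
  have hd : MDifferentiableAt 𝓘(ℝ, ℂ) 𝓘(ℝ, E) φ 0 := by
    have h1 : MDifferentiableAt 𝓘(ℝ, ℂ) 𝓘(ℝ, E) (fun z : ℂ => γ z.re) 0 :=
      MDifferentiableAt.comp (g := γ) (0 : ℂ) (hγd _) hre.mdifferentiableAt
    have h2 : MDifferentiableAt 𝓘(ℝ, ℂ) 𝓘(ℝ, E) (fun z : ℂ => γ' z.im) 0 :=
      MDifferentiableAt.comp (g := γ') (0 : ℂ) (hγd' _) him.mdifferentiableAt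
    exact MDifferentiableAt.comp (g := fun p : G × G => p.1 * p.2) (0 : ℂ)
      ((contMDiff_mul 𝓘(ℝ, E) ∞).mdifferentiableAt (by simp)) (h1.prodMk h2)
  obtain ⟨D, hD⟩ : ∃ D : ℂ →L[ℝ] E, HasMFDerivAt 𝓘(ℝ, ℂ) 𝓘(ℝ, E) φ 0 D := ⟨_, hd.hasMFDerivAt⟩
  have axis : ∀ (L : ℝ →L[ℝ] ℂ) (δ : ℝ → G) (w : E), φ ∘ L = δ →
      HasMFDerivAt 𝓘(ℝ, ℝ) 𝓘(ℝ, E) δ 0 ((1 : ℝ →L[ℝ] ℝ).smulRight w) → D (L 1) = w := by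
    intro L δ w e hδ
    have h1 : HasMFDerivAt 𝓘(ℝ, ℝ) 𝓘(ℝ, ℂ) L 0 L := L.hasFDerivAt.hasMFDerivAt
    have h2 : HasMFDerivAt 𝓘(ℝ, ℂ) 𝓘(ℝ, E) φ (L 0) D := by rw [map_zero]; exact hD
    have h3 := HasMFDerivAt.comp (0 : ℝ) h2 h1
    rw [e] at h3
    have h4 := hasMFDerivAt_unique h3 hδ
    have h5 := congrArg (fun L : ℝ →L[ℝ] E => L 1) h4
    refine Eq.trans h5 ?_
    exact one_smul ℝ w
  have hD1 : D 1 = v := by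
    have := axis Complex.ofRealCLM γ v (by funext x; simp [φ, h0']) hγ0
    simpa using this
  have hDI : D Complex.I = Complex.I • v := by
    have := axis (Complex.ofRealCLM.smulRight Complex.I : ℝ →L[ℝ] ℂ) γ' (Complex.I • v)
      (by funext x; simp [φ, h0]) hγ0'
    simpa using this
  -- The values `v` and `i v` on the real basis `1`, `i` make `D` complex linear. Left translation
  -- then carries holomorphy from `0` to every point.
  have hDeq : D = ((1 : ℂ →L[ℂ] ℂ).smulRight v).restrictScalars ℝ := by
    ext z
    have hz : z = z.re • (1 : ℂ) + z.im • Complex.I := by simp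
    have hw : z • v = z.re • v + z.im • Complex.I • v := by
      conv_lhs => rw [hz]
      rw [add_smul, smul_assoc, smul_assoc, one_smul]
    conv_lhs => rw [hz]
    rw [map_add, map_smul, map_smul, hD1, hDI, ← hw]
    rfl
  have hφ0 : HasMFDerivAt 𝓘(ℂ, ℂ) 𝓘(ℂ, E) φ 0 ((1 : ℂ →L[ℂ] ℂ).smulRight v) := by
    rw [hDeq] at hD
    exact hD.complex_of_real
  refine ⟨φ, fun z => ?_, hφ, hφ0⟩
  have hsub : HasMFDerivAt 𝓘(ℂ, ℂ) 𝓘(ℂ, ℂ) (fun s : ℂ => s - z) z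
      (ContinuousLinearMap.id ℂ ℂ) :=
    ((hasFDerivAt_id z).sub_const z).hasMFDerivAt
  have hL : MDifferentiableAt 𝓘(ℂ, E) 𝓘(ℂ, E) (fun g : G => φ z * g) (φ (z - z)) :=
    (contMDiff_mul_left (I := 𝓘(ℂ, E)) (n := ω)).mdifferentiableAt (by simp)
  have hv' : MDifferentiableAt 𝓘(ℂ, ℂ) 𝓘(ℂ, E) φ (z - z) := by
    rw [sub_self]; exact hφ0.mdifferentiableAt
  have h2 := hL.comp z (MDifferentiableAt.comp (g := φ) (f := fun s : ℂ => s - z) z hv'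
    hsub.mdifferentiableAt)
  have e : (fun g : G => φ z * g) ∘ φ ∘ (fun s : ℂ => s - z) = φ := by
    funext s
    simp [← hφ]
  rwa [e] at h2

end ComplexOneParameter

/-! ### Analyticity of holomorphic curves. -/

section HolomorphicCurve

variable {E : Type*} [NormedAddCommGroup E] [NormedSpace ℂ E]
  {M : Type*} [TopologicalSpace M] [ChartedSpace E M] [IsManifold 𝓘(ℂ, E) ω M]

/-- A holomorphic curve is holomorphic in charts. -/
theorem MDifferentiable.differentiableOn_extChartAt_comp {f : ℂ → M}
    (hf : MDifferentiable 𝓘(ℂ, ℂ) 𝓘(ℂ, E) f) (x : M) :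
    DifferentiableOn ℂ (extChartAt 𝓘(ℂ, E) x ∘ f) (f ⁻¹' (chartAt E x).source) := by
  have : IsManifold 𝓘(ℂ, E) 1 M := .of_le (n := ω) (by simp)
  intro t ht
  have h1 := (mdifferentiableAt_extChartAt (I := 𝓘(ℂ, E)) ht).comp t (hf t)
  exact (mdifferentiableAt_iff_differentiableAt.1 h1).differentiableWithinAt

/-- A holomorphic curve is analytic. -/
theorem MDifferentiable.contMDiff_of_complex [CompleteSpace E] {f : ℂ → M}
    (hf : MDifferentiable 𝓘(ℂ, ℂ) 𝓘(ℂ, E) f) : ContMDiff 𝓘(ℂ, ℂ) 𝓘(ℂ, E) ω f := by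
  intro t
  refine contMDiffAt_iff.2 ⟨(hf t).continuousAt, ?_⟩
  have h1 := hf.differentiableOn_extChartAt_comp (f t)
  have hs : f ⁻¹' (chartAt E (f t)).source ∈ 𝓝 t :=
    hf.continuous.continuousAt.preimage_mem_nhds
      ((chartAt E (f t)).open_source.mem_nhds (mem_chart_source E (f t)))
  exact (h1.analyticAt hs).contDiffAt.contDiffWithinAt

end HolomorphicCurve

/-! ### Openness of subgroups containing one-parameter groups in all directions. -/

section Generation

variable {E : Type*} [NormedAddCommGroup E] [NormedSpace ℂ E]
  {G : Type*} [Group G] [TopologicalSpace G] [ChartedSpace E G] [LieGroup 𝓘(ℂ, E) ω G]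

/-- The factors need not commute, hence a product along a list. -/
theorem contMDiff_list_prod_apply {ι : Type*} [Fintype ι] [CompleteSpace E] {φ : ι → ℂ → G}
    (hφ : ∀ i, MDifferentiable 𝓘(ℂ, ℂ) 𝓘(ℂ, E) (φ i)) (l : List ι) :
    ContMDiff 𝓘(ℂ, ι → ℂ) 𝓘(ℂ, E) ω (fun t : ι → ℂ => (l.map fun i => φ i (t i)).prod) := by
  induction l with
  | nil => exact contMDiff_const
  | cons i l ih =>
    have h1 : ContMDiff 𝓘(ℂ, ι → ℂ) 𝓘(ℂ, ℂ) ω (fun t : ι → ℂ => t i) :=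
      (ContinuousLinearMap.proj (R := ℂ) (φ := fun _ : ι => ℂ) i).contDiff.contMDiff
    have h2 : ContMDiff 𝓘(ℂ, ι → ℂ) 𝓘(ℂ, E) ω (fun t : ι → ℂ => φ i (t i)) :=
      (hφ i).contMDiff_of_complex.comp h1
    simp only [List.map_cons, List.prod_cons]
    exact h2.mul ih

/-- On a coordinate axis a single factor survives; this yields the partial derivatives at `0` of the
product map. -/
theorem List.prod_map_apply_single {ι M R : Type*} [DecidableEq ι] [Zero R] [Monoid M]
    {φ : ι → R → M} (hφ : ∀ i, φ i 0 = 1) (j : ι) (c : R) (l : List ι) (hl : l.Nodup) :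
    (l.map fun i => φ i ((Pi.single j c : ι → R) i)).prod = if j ∈ l then φ j c else 1 := by
  induction l with
  | nil => simp
  | cons i l ih =>
    rw [List.nodup_cons] at hl
    rw [List.map_cons, List.prod_cons, ih hl.2]
    by_cases h : j = i
    · subst h; simp [hl.1]
    · simp [h, Ne.symm h, hφ]

/-- A subgroup of a complex Lie group that contains one-parameter subgroups in all directions is
open. -/
theorem Subgroup.isOpen_of_oneParameter [FiniteDimensional ℂ E] (H : Subgroup G)
    (hH : ∀ v : E, ∃ φ : ℂ → G, MDifferentiable 𝓘(ℂ, ℂ) 𝓘(ℂ, E) φ ∧ φ 0 = 1 ∧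
      HasMFDerivAt 𝓘(ℂ, ℂ) 𝓘(ℂ, E) φ 0 ((1 : ℂ →L[ℂ] ℂ).smulRight v) ∧ ∀ t, φ t ∈ H) :
    IsOpen (H : Set G) := by
  classical
  have : CompleteSpace E := FiniteDimensional.complete ℂ E
  have : IsTopologicalGroup G := topologicalGroup_of_lieGroup 𝓘(ℂ, E) ω
  choose φ hφd hφ0 hφ' hφH using hH
  let b := Module.finBasis ℂ E
  let Φ : (Fin (Module.finrank ℂ E) → ℂ) → G := fun t =>
    ((Finset.univ : Finset (Fin (Module.finrank ℂ E))).toList.map fun i => φ (b i) (t i)).prod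
  have hΦ : ContMDiff 𝓘(ℂ, Fin (Module.finrank ℂ E) → ℂ) 𝓘(ℂ, E) ω Φ :=
    contMDiff_list_prod_apply (fun i => hφd (b i)) _
  have hΦs : ∀ j c, Φ (Pi.single j c) = φ (b j) c := fun j c => by
    have := List.prod_map_apply_single (φ := fun i => φ (b i)) (fun i => hφ0 (b i)) j c
      (Finset.univ : Finset (Fin (Module.finrank ℂ E))).toList (Finset.nodup_toList _)
    simpa using this
  have hΦ0 : Φ 0 = 1 := by simp [Φ, hφ0]
  obtain ⟨D, hD⟩ : ∃ D : (Fin (Module.finrank ℂ E) → ℂ) →L[ℂ] E,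
      HasMFDerivAt 𝓘(ℂ, Fin (Module.finrank ℂ E) → ℂ) 𝓘(ℂ, E) Φ 0 D :=
    ⟨_, (hΦ.mdifferentiableAt (by simp)).hasMFDerivAt⟩
  have hDb : ∀ j, D (Pi.single j 1) = b j := fun j => by
    let L : ℂ →L[ℂ] (Fin (Module.finrank ℂ E) → ℂ) :=
      ContinuousLinearMap.single ℂ (fun _ => ℂ) j
    have h1 : HasMFDerivAt 𝓘(ℂ, ℂ) 𝓘(ℂ, Fin (Module.finrank ℂ E) → ℂ) L 0 L :=
      L.hasFDerivAt.hasMFDerivAt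
    have h2 : HasMFDerivAt 𝓘(ℂ, Fin (Module.finrank ℂ E) → ℂ) 𝓘(ℂ, E) Φ (L 0) D := by
      rw [map_zero]; exact hD
    have h3 := HasMFDerivAt.comp (0 : ℂ) h2 h1
    have e : Φ ∘ L = φ (b j) := by funext c; exact hΦs j c
    rw [e] at h3
    have h5 := congrArg (fun L : ℂ →L[ℂ] E => L 1) (hasMFDerivAt_unique h3 (hφ' (b j)))
    exact Eq.trans h5 (one_smul ℂ (b j))
  have hsurj : Function.Surjective D := fun w => by
    refine ⟨∑ j, b.repr w j • Pi.single j 1, ?_⟩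
    rw [map_sum]
    simp only [map_smul, hDb]
    exact b.sum_repr w
  let u : (Fin (Module.finrank ℂ E) → ℂ) → E := extChartAt 𝓘(ℂ, E) (1 : G) ∘ Φ
  have hu : HasFDerivAt u D 0 := by
    have h := hD.2
    unfold writtenInExtChartAt at h
    rw [hΦ0] at h
    exact HasFDerivWithinAt.hasFDerivAt (s := Set.range id) h (by simp)
  have huc : ContDiffAt ℂ ω u 0 := by
    have h := (contMDiffAt_iff.1 (hΦ 0)).2
    rw [hΦ0] at h
    exact ContDiffWithinAt.contDiffAt (s := Set.range id) h (by simp)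
  have hus : HasStrictFDerivAt u D 0 := huc.hasStrictFDerivAt' hu (by simp)
  -- A surjective strict derivative makes `u` map neighbourhoods of `0` onto neighbourhoods. As `Φ`
  -- takes values in `H`, the subgroup contains a neighbourhood of `1`.
  have hopen := hus.map_nhds_eq_of_surj (LinearMap.range_eq_top.2 hsurj)
  refine H.isOpen_of_mem_nhds (g := 1) ?_
  have hev : ∀ᶠ y in 𝓝 (u 0), (extChartAt 𝓘(ℂ, E) (1 : G)).symm y ∈ H := by
    rw [← hopen, Filter.eventually_map]
    have hs : ∀ᶠ t in 𝓝 0, Φ t ∈ (extChartAt 𝓘(ℂ, E) (1 : G)).source :=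
      hΦ.continuous.continuousAt.eventually
        (by rw [hΦ0]; exact extChartAt_source_mem_nhds (1 : G))
    filter_upwards [hs] with t ht
    rw [show u t = extChartAt 𝓘(ℂ, E) (1 : G) (Φ t) from rfl, PartialEquiv.left_inv _ ht]
    exact H.list_prod_mem (by simp only [List.mem_map]; rintro _ ⟨i, -, rfl⟩; exact hφH _ _)
  have hu0 : u 0 = extChartAt 𝓘(ℂ, E) (1 : G) 1 := by simp [u, hΦ0]
  rw [hu0] at hev
  filter_upwards [(continuousAt_extChartAt (1 : G)).eventually hev,
    extChartAt_source_mem_nhds (I := 𝓘(ℂ, E)) (1 : G)] with g hg hgs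
  rwa [PartialEquiv.left_inv _ hgs] at hg

end Generation

/-! ### Vanishing of the Kobayashi pseudometrics along entire curves. -/

section Kobayashi

open SKT

variable {F : Type*} [NormedAddCommGroup F] [NormedSpace ℂ F]
  {X : Type*} [TopologicalSpace X] [ChartedSpace F X]

theorem mdifferentiable_comp_const_mul {f : ℂ → X} (hf : MDifferentiable 𝓘(ℂ, ℂ) 𝓘(ℂ, F) f)
    (R : ℂ) : MDifferentiable 𝓘(ℂ, ℂ) 𝓘(ℂ, F) (fun z => f (R * z)) := fun z =>
  MDifferentiableAt.comp (g := f) (f := fun z => R * z) z (hf _)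
    (differentiableAt_id.const_mul R).mdifferentiableAt

theorem poincareDist_zero_left (b : ℂ) :
    poincareDist 0 b = Real.log ((1 + ‖b‖) / (1 - ‖b‖)) := by
  simp [poincareDist]

/-- Points on a common entire curve have zero disc distance. -/
theorem discDist_eq_zero_of_entire {f : ℂ → X} (hf : MDifferentiable 𝓘(ℂ, ℂ) 𝓘(ℂ, F) f) (t : ℂ) :
    discDist F (f 0) (f t) = 0 := by
  have hlim : Filter.Tendsto (fun R : ℝ => ENNReal.ofReal (poincareDist 0 (t / R))) Filter.atTop
      (𝓝 0) := by
    have h1 : Filter.Tendsto (fun R : ℝ => ‖t / (R : ℂ)‖) Filter.atTop (𝓝 0) := by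
      have : (fun R : ℝ => ‖t / (R : ℂ)‖) = fun R : ℝ => ‖t‖ / |R| := by
        funext R; simp
      rw [this]
      exact Filter.Tendsto.const_div_atTop Filter.tendsto_abs_atTop_atTop _
    have hc : ContinuousAt (fun r : ℝ => ENNReal.ofReal (Real.log ((1 + r) / (1 - r)))) 0 := by
      refine ENNReal.continuous_ofReal.continuousAt.comp ?_
      refine ContinuousAt.log ?_ (by simp)
      exact ContinuousAt.div (by fun_prop) (by fun_prop) (by simp)
    have h2 := hc.tendsto.comp h1
    simp only [poincareDist_zero_left]
    simpa [Function.comp_def] using h2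
  refine le_antisymm (ge_of_tendsto hlim ?_) zero_le
  filter_upwards [Filter.eventually_gt_atTop ‖t‖] with R hR
  have hR0 : 0 < R := (norm_nonneg t).trans_lt hR
  have hRc : (R : ℂ) ≠ 0 := by exact_mod_cast hR0.ne'
  unfold discDist
  -- The rescaled disc reaches `f t` at `t / R`, which lies in the unit disc once `R > ‖t‖` and
  -- tends to `0`.
  refine iInf_le_of_le (fun z => f (R * z)) (iInf_le_of_le 0 (iInf_le_of_le (t / R)
    (iInf_le_of_le (mdifferentiable_comp_const_mul hf R).mdifferentiableOn
      (iInf_le_of_le (by simp) (iInf_le_of_le ?_ (iInf_le_of_le (by simp)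
        (iInf_le_of_le ?_ le_rfl)))))))
  · rw [mem_ball_zero_iff, norm_div, Complex.norm_real, Real.norm_eq_abs, abs_of_pos hR0]
    exact (div_lt_one hR0).2 hR
  · change f (R * (t / R)) = f t
    rw [mul_div_cancel₀ t hRc]

/-- Points joined by a chain of zero disc distances have zero Kobayashi distance. -/
theorem kobayashiDist_eq_zero_of_reflTransGen {p q : X}
    (h : Relation.ReflTransGen (fun p q : X => discDist F p q = 0) p q) :
    kobayashiDist F p q = 0 := by
  suffices H : ∃ (n : ℕ) (c : ℕ → X), c 0 = p ∧ c n = q ∧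
      ∀ i, i < n → discDist F (c i) (c (i + 1)) = 0 by
    obtain ⟨n, c, h0, hn, hc⟩ := H
    refine le_antisymm ?_ zero_le
    unfold kobayashiDist
    refine iInf_le_of_le n (iInf_le_of_le c (iInf_le_of_le h0 (iInf_le_of_le hn ?_)))
    exact (Finset.sum_eq_zero fun i hi => hc i (Finset.mem_range.1 hi)).le
  induction h using Relation.ReflTransGen.head_induction_on with
  | refl => exact ⟨0, fun _ => q, rfl, rfl, by simp⟩
  | head h _ ih =>
    rename_i a b _
    obtain ⟨n, c, h0, hn, hc⟩ := ih
    refine ⟨n + 1, fun i => Nat.casesOn i a c, rfl, hn, fun i hi => ?_⟩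
    cases i with
    | zero => simpa [h0] using h
    | succ i => exact hc i (by lia)

/-- The Kobayashi–Royden pseudometric vanishes on velocities of entire curves. -/
theorem kobayashiRoyden_eq_zero_of_entire {f : ℂ → X} (hf : MDifferentiable 𝓘(ℂ, ℂ) 𝓘(ℂ, F) f)
    {ξ : TangentBundle 𝓘(ℂ, F) X}
    (hξ : tangentMap 𝓘(ℂ, ℂ) 𝓘(ℂ, F) f ⟨0, (1 : ℂ)⟩ = ξ) : kobayashiRoyden ξ = 0 := by
  have hlim : Filter.Tendsto (fun R : ℝ => ‖(R : ℂ)⁻¹‖ₑ) Filter.atTop (𝓝 0) := by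
    have h1 : Filter.Tendsto (fun R : ℝ => (R : ℂ)⁻¹) Filter.atTop (𝓝 0) := by
      rw [tendsto_zero_iff_norm_tendsto_zero]
      have : (fun R : ℝ => ‖(R : ℂ)⁻¹‖) = fun R : ℝ => |R|⁻¹ := by funext R; simp
      rw [this]
      exact tendsto_inv_atTop_zero.comp Filter.tendsto_abs_atTop_atTop
    simpa using h1.enorm
  refine le_antisymm (ge_of_tendsto hlim ?_) zero_le
  filter_upwards [Filter.eventually_gt_atTop 0] with R hR
  have hRc : (R : ℂ) ≠ 0 := by exact_mod_cast hR.ne'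
  unfold kobayashiRoyden
  -- The rescaled disc sends the vector `1 / R` at `0` to `ξ`.
  refine iInf_le_of_le (fun z => f (R * z)) (iInf_le_of_le (R : ℂ)⁻¹
    (iInf_le_of_le (mdifferentiable_comp_const_mul hf R).mdifferentiableOn
      (iInf_le_of_le ?_ le_rfl)))
  change tangentMap 𝓘(ℂ, ℂ) 𝓘(ℂ, F) (f ∘ fun z => (R : ℂ) * z) ⟨0, ((R : ℂ)⁻¹ : ℂ)⟩ = ξ
  have hm : HasMFDerivAt 𝓘(ℂ, ℂ) 𝓘(ℂ, ℂ) (fun z : ℂ => (R : ℂ) * z) 0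
      ((R : ℂ) • ContinuousLinearMap.id ℂ ℂ) :=
    ((hasFDerivAt_id (0 : ℂ)).const_mul (R : ℂ)).hasMFDerivAt
  rw [tangentMap_comp_at _ (hf _) hm.mdifferentiableAt, ← hξ]
  congr 1
  have mk_congr : ∀ {a b x y : ℂ}, a = b → x = y →
      (⟨a, x⟩ : TangentBundle 𝓘(ℂ, ℂ) ℂ) = ⟨b, y⟩ := by
    rintro a _ x _ rfl rfl
    rfl
  simp only [tangentMap, hm.mfderiv]
  exact mk_congr (mul_zero _) (mul_inv_cancel₀ hRc)

end Kobayashi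

/-! ### Entire curves and Kobayashi distance on `G ⧸ Γ`. -/

section Homogeneous

open SKT

variable {E : Type*} [NormedAddCommGroup E] [NormedSpace ℂ E]
  {F : Type*} [NormedAddCommGroup F] [NormedSpace ℂ F]
  {G : Type*} [Group G] [TopologicalSpace G] [ChartedSpace E G] [LieGroup 𝓘(ℂ, E) ω G]
  {Γ : Subgroup G} [ChartedSpace F (G ⧸ Γ)]

/-- The orbits of a holomorphic curve of group elements are holomorphic. -/
theorem mdifferentiable_smul_quotient
    (hπ : MDifferentiable 𝓘(ℂ, E) 𝓘(ℂ, F) (fun g : G => (g : G ⧸ Γ)))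
    {φ : ℂ → G} (hφ : MDifferentiable 𝓘(ℂ, ℂ) 𝓘(ℂ, E) φ) (p : G ⧸ Γ) :
    MDifferentiable 𝓘(ℂ, ℂ) 𝓘(ℂ, F) (fun t => φ t • p) := by
  obtain ⟨g, rfl⟩ := QuotientGroup.mk_surjective p
  have hR : MDifferentiable 𝓘(ℂ, E) 𝓘(ℂ, E) (fun x : G => x * g) :=
    (contMDiff_mul_right (I := 𝓘(ℂ, E)) (n := ω)).mdifferentiable (by simp)
  exact hπ.comp (hR.comp hφ)

/-- Every tangent vector of `G ⧸ Γ` is the velocity of an orbit of a complex one-parameter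
subgroup. -/
theorem exists_oneParameter_orbit [CompleteSpace E] [T2Space G]
    (hπ : MDifferentiable 𝓘(ℂ, E) 𝓘(ℂ, F) (fun g : G => (g : G ⧸ Γ)))
    (hπ' : ∀ g : G, Function.Surjective
      (mfderiv 𝓘(ℂ, E) 𝓘(ℂ, F) (fun g : G => (g : G ⧸ Γ)) g))
    (ξ : TangentBundle 𝓘(ℂ, F) (G ⧸ Γ)) :
    ∃ φ : ℂ → G, MDifferentiable 𝓘(ℂ, ℂ) 𝓘(ℂ, E) φ ∧ (∀ s t : ℂ, φ (s + t) = φ s * φ t) ∧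
      tangentMap 𝓘(ℂ, ℂ) 𝓘(ℂ, F) (fun t : ℂ => φ t • ξ.1) ⟨0, (1 : ℂ)⟩ = ξ := by
  obtain ⟨p, ξ⟩ := ξ
  obtain ⟨g, rfl⟩ := QuotientGroup.mk_surjective p
  obtain ⟨w, hw⟩ := hπ' g ξ
  have hR : ∀ a : G, MDifferentiable 𝓘(ℂ, E) 𝓘(ℂ, E) (fun x : G => x * a) := fun a =>
    (contMDiff_mul_right (I := 𝓘(ℂ, E)) (n := ω)).mdifferentiable (by simp)
  -- The orbit `φ t • gΓ` is the projection of `φ t * g`, so the generator is `w` right-translated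
  -- from `g` to the identity.
  let v : E := mfderiv 𝓘(ℂ, E) 𝓘(ℂ, E) (fun x : G => x * g⁻¹) g w
  obtain ⟨φ, hφ, hhom, hφ0⟩ := exists_complex_oneParameter (G := G) v
  refine ⟨φ, hφ, hhom, ?_⟩
  have h0 : φ 0 = 1 := by simpa using hhom 0 0
  have e1 : tangentMap 𝓘(ℂ, ℂ) 𝓘(ℂ, E) φ ⟨0, (1 : ℂ)⟩ =
      tangentMap 𝓘(ℂ, E) 𝓘(ℂ, E) (fun x : G => x * g⁻¹) ⟨g, w⟩ := by
    have h1 : tangentMap 𝓘(ℂ, ℂ) 𝓘(ℂ, E) φ ⟨0, (1 : ℂ)⟩ =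
        (⟨φ 0, v⟩ : TangentBundle 𝓘(ℂ, E) G) := by
      simp only [tangentMap, hφ0.mfderiv]
      congr 1
      exact one_smul ℂ v
    have h2 : φ 0 = g * g⁻¹ := by simp [h0]
    rw [h1, h2]
    rfl
  change tangentMap 𝓘(ℂ, ℂ) 𝓘(ℂ, F) ((fun g : G => (g : G ⧸ Γ)) ∘ ((fun x : G => x * g) ∘ φ))
    ⟨0, (1 : ℂ)⟩ = _
  rw [tangentMap_comp_at _ (hπ _) ((hR g).comp hφ _), tangentMap_comp_at _ (hR g _) (hφ _), e1,
    ← tangentMap_comp_at _ (hR g _) (hR g⁻¹ _)]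
  have e2 : (fun x : G => x * g) ∘ (fun x : G => x * g⁻¹) = id := by
    funext x; simp
  rw [e2, tangentMap_id]
  simp only [id, tangentMap, hw]

/-- The Kobayashi pseudodistance of a connected complex homogeneous space vanishes. -/
theorem kobayashiDist_quotient_eq_zero [FiniteDimensional ℂ E] [T2Space G]
    (hπ : MDifferentiable 𝓘(ℂ, E) 𝓘(ℂ, F) (fun g : G => (g : G ⧸ Γ)))
    [ConnectedSpace (G ⧸ Γ)] (p q : G ⧸ Γ) : kobayashiDist F p q = 0 := by
  have : CompleteSpace E := FiniteDimensional.complete ℂ E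
  have : IsTopologicalGroup G := topologicalGroup_of_lieGroup 𝓘(ℂ, E) ω
  let r : G ⧸ Γ → G ⧸ Γ → Prop := Relation.ReflTransGen (fun p q => discDist F p q = 0)
  -- The relation `r` is not known to be symmetric, so `h` and `h⁻¹` are both constrained.
  let H : Subgroup G :=
    { carrier := {h | ∀ p : G ⧸ Γ, r p (h • p) ∧ r p (h⁻¹ • p)}
      one_mem' := fun p => by simpa using Relation.ReflTransGen.refl
      mul_mem' := fun {a b} ha hb p => by
        rw [mul_inv_rev, mul_smul, mul_smul]
        exact ⟨(hb p).1.trans (ha _).1, (ha p).2.trans (hb _).2⟩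
      inv_mem' := fun {a} ha p => by
        rw [inv_inv]
        exact ⟨(ha p).2, (ha p).1⟩ }
  have hH : IsOpen (H : Set G) := by
    refine Subgroup.isOpen_of_oneParameter (E := E) H fun v => ?_
    obtain ⟨φ, hφ, hhom, hφ0⟩ := exists_complex_oneParameter (G := G) v
    have h0 : φ 0 = 1 := by simpa using hhom 0 0
    have hr : ∀ t (p : G ⧸ Γ), r p (φ t • p) := fun t p => by
      have := discDist_eq_zero_of_entire (mdifferentiable_smul_quotient hπ hφ p) t
      rw [h0, one_smul] at this
      exact Relation.ReflTransGen.single this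
    refine ⟨φ, hφ, h0, hφ0, fun t p => ⟨hr t p, ?_⟩⟩
    have : (φ t)⁻¹ = φ (-t) := by
      rw [inv_eq_iff_mul_eq_one, ← hhom, add_neg_cancel, h0]
    rw [this]
    exact hr _ p
  -- The orbit of `gΓ` is the image of the open set `H g` under the open quotient map.
  have horb : ∀ p : G ⧸ Γ, IsOpen {x : G ⧸ Γ | ∃ h ∈ H, h • p = x} := fun p => by
    obtain ⟨g, rfl⟩ := QuotientGroup.mk_surjective p
    have h1 := QuotientGroup.isOpenMap_coe (N := Γ) _ ((Homeomorph.mulRight g).isOpenMap _ hH)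
    convert h1 using 1
    ext x
    simp only [Set.mem_ofPred_eq, Set.mem_image, SetLike.mem_coe, exists_exists_and_eq_and]
    rfl
  -- Orbits partition the space, so the complement of one is a union of open orbits.
  have hclopen : IsClopen {x : G ⧸ Γ | ∃ h ∈ H, h • p = x} := by
    refine ⟨⟨isOpen_iff_mem_nhds.2 fun y hy => ?_⟩, horb p⟩
    refine Filter.mem_of_superset ((horb y).mem_nhds ⟨1, H.one_mem, one_smul _ _⟩) ?_
    rintro _ ⟨h, hh, rfl⟩ ⟨k, hk, hkp⟩
    exact hy ⟨h⁻¹ * k, H.mul_mem (H.inv_mem hh) hk, by rw [mul_smul, hkp, inv_smul_smul]⟩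
  have huniv := hclopen.eq_univ ⟨p, 1, H.one_mem, one_smul _ _⟩
  obtain ⟨h, hh, rfl⟩ := huniv.symm ▸ Set.mem_univ q
  exact kobayashiDist_eq_zero_of_reflTransGen (hh p).1

end Homogeneous

/-! ### Parabolicity of the plane and a Liouville-type vanishing theorem. -/

section Parabolicity

open MeasureTheory

/-- A Caccioppoli-type inequality: integration by parts against the square of a cutoff. -/
theorem integral_cutoff_sq_le {p q s : ℂ → ℝ} {C : ℝ} (hp : ContDiff ℝ 1 p) (hq : ContDiff ℝ 1 q)
    (hs : Continuous s) (hps : ∀ z, |p z| ≤ C * s z) (hqs : ∀ z, |q z| ≤ C * s z)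
    (hpq : ∀ z, s z ^ 2 = fderiv ℝ p z 1 + fderiv ℝ q z Complex.I)
    {χ : ℂ → ℝ} (hχ : ContDiff ℝ 1 χ) (hχc : HasCompactSupport χ) :
    ∫ z, χ z ^ 2 * s z ^ 2 ≤ 16 * C ^ 2 * ∫ z, ‖fderiv ℝ χ z‖ ^ 2 := by
  have hdχ : Continuous (fderiv ℝ χ) := hχ.continuous_fderiv (by simp)
  -- The integrand is the derivative of the compactly supported function `χ² f` in the direction
  -- `v`.
  have div_zero : ∀ (f : ℂ → ℝ) (v : ℂ), ContDiff ℝ 1 f →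
      Integrable (fun z => χ z ^ 2 * fderiv ℝ f z v + 2 * χ z * fderiv ℝ χ z v * f z) ∧
      ∫ z, (χ z ^ 2 * fderiv ℝ f z v + 2 * χ z * fderiv ℝ χ z v * f z) = 0 := by
    intro f v hf
    have hdf : Continuous (fderiv ℝ f) := hf.continuous_fderiv (by simp)
    have hχ2 : ∀ z, fderiv ℝ (fun z => χ z ^ 2) z v = 2 * χ z * fderiv ℝ χ z v := fun z => by
      have h := ((hχ.differentiable (by simp) z).hasFDerivAt.pow 2).fderiv
      rw [h]
      simp
    have i1 : Integrable (fun z => χ z ^ 2 * fderiv ℝ f z v) :=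
      Continuous.integrable_of_hasCompactSupport (by fun_prop)
        (hχc.mono fun z hz h0 => hz (by simp [h0]))
    have i2 : Integrable (fun z => 2 * χ z * fderiv ℝ χ z v * f z) :=
      Continuous.integrable_of_hasCompactSupport (by fun_prop)
        (hχc.mono fun z hz h0 => hz (by simp [h0]))
    have i3 : Integrable (fun z => χ z ^ 2 * f z) :=
      Continuous.integrable_of_hasCompactSupport (by fun_prop)
        (hχc.mono fun z hz h0 => hz (by simp [h0]))
    refine ⟨i1.add i2, ?_⟩
    rw [integral_add i1 i2]
    have h := integral_mul_fderiv_eq_neg_fderiv_mul_of_integrable (μ := volume)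
      (f := fun z => χ z ^ 2) (g := f) (v := v) (by simpa only [hχ2] using i2) i1 i3
      (fun z _ => (hχ.differentiable (by simp) z).pow 2)
      (fun z _ => hf.differentiable (by simp) z)
    simp only [hχ2] at h
    rw [h, neg_add_cancel]
  obtain ⟨ip, hp0⟩ := div_zero p 1 hp
  obtain ⟨iq, hq0⟩ := div_zero q Complex.I hq
  have is : Integrable (fun z => χ z ^ 2 * s z ^ 2) :=
    Continuous.integrable_of_hasCompactSupport (by have := hχ.continuous; fun_prop)
      (hχc.mono fun z hz h0 => hz (by simp [h0]))
  have id' : Integrable (fun z => ‖fderiv ℝ χ z‖ ^ 2) :=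
    Continuous.integrable_of_hasCompactSupport (by fun_prop)
      ((hχc.fderiv (𝕜 := ℝ)).mono fun z hz h0 => hz (by simp [h0]))
  -- With `N = ‖dχ‖`, the cross terms are at least `-4 C N |χ| s`, and `(|χ| s - 4 C N)² ≥ 0`
  -- absorbs them into half of `χ² s²`. The right side integrates to `0`.
  have key : ∀ z, 1 / 2 * (χ z ^ 2 * s z ^ 2) - 8 * C ^ 2 * ‖fderiv ℝ χ z‖ ^ 2 ≤
      (χ z ^ 2 * fderiv ℝ p z 1 + 2 * χ z * fderiv ℝ χ z 1 * p z) +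
      (χ z ^ 2 * fderiv ℝ q z Complex.I + 2 * χ z * fderiv ℝ χ z Complex.I * q z) := by
    intro z
    have b1 : |fderiv ℝ χ z 1| ≤ ‖fderiv ℝ χ z‖ := by
      simpa using (fderiv ℝ χ z).le_opNorm 1
    have b2 : |fderiv ℝ χ z Complex.I| ≤ ‖fderiv ℝ χ z‖ := by
      simpa using (fderiv ℝ χ z).le_opNorm Complex.I
    set N := ‖fderiv ℝ χ z‖
    have c1 : |χ z * fderiv ℝ χ z 1 * p z| ≤ |χ z| * N * (C * s z) := by
      rw [abs_mul, abs_mul]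
      have := hps z
      gcongr
    have c2 : |χ z * fderiv ℝ χ z Complex.I * q z| ≤ |χ z| * N * (C * s z) := by
      rw [abs_mul, abs_mul]
      have := hqs z
      gcongr
    have c1' := (abs_le.1 c1).1
    have c2' := (abs_le.1 c2).1
    have e : χ z ^ 2 * s z ^ 2 =
      χ z ^ 2 * fderiv ℝ p z 1 + χ z ^ 2 * fderiv ℝ q z Complex.I := by rw [hpq]; ring
    have hsq := sq_nonneg (|χ z| * s z - 4 * C * N)
    have habs : |χ z| ^ 2 = χ z ^ 2 := sq_abs _
    nlinarith
  have hint := integral_mono ((is.const_mul (1 / 2)).sub (id'.const_mul (8 * C ^ 2)))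
    (ip.add iq) key
  rw [integral_sub' (is.const_mul _) (id'.const_mul _), integral_add' ip iq, hp0, hq0,
    integral_const_mul, integral_const_mul] at hint
  linarith

/-- `∫ (1 + |z|²)^(-1-δ)` is `O(1/δ)`. -/
theorem integral_one_add_norm_sq_rpow_le {δ : ℝ} (hδ : 0 < δ) :
    Integrable (fun z : ℂ => (1 + ‖z‖ ^ 2) ^ (-1 - δ)) ∧
    ∫ z : ℂ, (1 + ‖z‖ ^ 2) ^ (-1 - δ) = Real.pi / δ := by
  constructor
  · have h := integrable_rpow_neg_one_add_norm_sq (E := ℂ) (μ := volume) (r := 2 + 2 * δ)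
      (by rw [Complex.finrank_real_complex]; push_cast; linarith)
    convert h using 3
    ring
  · have h := integral_fun_norm_addHaar (E := ℂ) volume (fun r : ℝ => (1 + r ^ 2) ^ (-1 - δ))
    rw [h, Complex.finrank_real_complex]
    -- Primitive of the radial integrand in polar coordinates: `2 π` times `1 / (2 δ)` is `π / δ`.
    have hd : ∀ y ∈ Set.Ici (0 : ℝ), HasDerivAt (fun y : ℝ => -(1 / (2 * δ)) * (1 + y ^ 2) ^ (-δ))
        (y ^ (2 - 1) • (1 + y ^ 2) ^ (-1 - δ)) y := by
      intro y _
      have hy : (0 : ℝ) < 1 + y ^ 2 := by positivity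
      have h1 : HasDerivAt (fun y : ℝ => 1 + y ^ 2) (2 * y) y := by
        simpa using (hasDerivAt_pow 2 y).const_add 1
      refine ((h1.rpow_const (p := -δ) (Or.inl hy.ne')).const_mul (-(1 / (2 * δ)))).congr_deriv ?_
      rw [show -δ - 1 = -1 - δ by ring, smul_eq_mul]
      field_simp
      ring
    have hlim : Filter.Tendsto (fun y : ℝ => -(1 / (2 * δ)) * (1 + y ^ 2) ^ (-δ)) Filter.atTop
        (𝓝 0) := by
      rw [← mul_zero (-(1 / (2 * δ)))]
      refine Filter.Tendsto.const_mul _ ((tendsto_rpow_neg_atTop hδ).comp ?_)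
      exact Filter.tendsto_atTop_add_const_left _ _ (Filter.tendsto_pow_atTop (by simp))
    rw [integral_Ioi_of_hasDerivAt_of_nonneg' hd (fun y hy => by
      have hy' : (0 : ℝ) < y := hy
      rw [smul_eq_mul]; positivity) hlim]
    simp [Measure.real, Complex.volume_ball]
    field_simp

/-- Parabolicity of the complex plane: there are cutoff functions with arbitrarily small Dirichlet
energy. -/
theorem exists_cutoff_energy_le (R : ℝ) {ε : ℝ} (hε : 0 < ε) :
    ∃ χ : ℂ → ℝ, ContDiff ℝ 1 χ ∧ HasCompactSupport χ ∧ (∀ z, ‖z‖ ≤ R → χ z = 1) ∧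
      ∫ z, ‖fderiv ℝ χ z‖ ^ 2 ≤ ε := by
  let ψ : ContDiffBump (0 : ℝ) := ⟨1, 2, by norm_num, by norm_num⟩
  have hψ : ContDiff ℝ 1 ψ := ψ.contDiff
  obtain ⟨M, hM⟩ : ∃ M, ∀ x, ‖deriv ψ x‖ ≤ M :=
    (hψ.continuous_deriv le_rfl).bounded_above_of_compact_support ψ.hasCompactSupport.deriv
  have hM0 : 0 ≤ M := (norm_nonneg _).trans (hM 0)
  -- Logarithmic cutoff: `χ = ψ (l / n)` varies only where `n ≤ l ≤ 2 n`, and its energy is `O(1 /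
  -- n)`.
  let l : ℂ → ℝ := fun z => Real.log (1 + ‖z‖ ^ 2)
  have hpos : ∀ z : ℂ, 0 < 1 + ‖z‖ ^ 2 := fun z => by positivity
  have hl0 : ∀ z, 0 ≤ l z := fun z => Real.log_nonneg (by simp)
  have hl : ContDiff ℝ 1 l := (contDiff_const.add (contDiff_norm_sq ℝ)).log fun z => (hpos z).ne'
  have hdl : ∀ z, ‖fderiv ℝ l z‖ ^ 2 ≤ 4 * (1 + ‖z‖ ^ 2)⁻¹ := fun z => by
    have h1 : HasFDerivAt (fun z : ℂ => 1 + ‖z‖ ^ 2) (2 • (innerSL ℝ z)) z :=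
      (hasStrictFDerivAt_norm_sq z).hasFDerivAt.const_add 1
    have h2 := (h1.log (hpos z).ne').fderiv
    have h3 : ‖fderiv ℝ l z‖ = (1 + ‖z‖ ^ 2)⁻¹ * (2 * ‖z‖) := by
      rw [show fderiv ℝ l z = _ from h2, norm_smul, ← Nat.cast_smul_eq_nsmul ℝ, norm_smul,
        innerSL_apply_norm]
      simp [abs_of_pos (hpos z)]
    rw [h3, mul_pow, sq (1 + ‖z‖ ^ 2)⁻¹, mul_assoc, mul_comm 4]
    refine mul_le_mul_of_nonneg_left ?_ (inv_nonneg.2 (hpos z).le)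
    rw [inv_mul_le_iff₀ (hpos z)]
    nlinarith
  obtain ⟨n, hn1, hnR, hnε⟩ : ∃ n : ℝ, 0 < n ∧ Real.log (1 + R ^ 2) ≤ n ∧
      4 * M ^ 2 * Real.exp 2 * Real.pi / n ≤ ε := by
    refine ⟨max 1 (max (Real.log (1 + R ^ 2)) (4 * M ^ 2 * Real.exp 2 * Real.pi / ε)),
      by positivity, le_max_of_le_right (le_max_left _ _), ?_⟩
    rw [div_le_comm₀ (by positivity) hε]
    exact le_max_of_le_right (le_max_right _ _)
  let χ : ℂ → ℝ := fun z => ψ (l z / n)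
  have hχ : ContDiff ℝ 1 χ := hψ.comp (hl.div_const n)
  have hzero : ∀ z, 2 * n < l z → χ z = 0 := fun z hz => by
    refine ψ.zero_of_le_dist ?_
    rw [Real.dist_eq, sub_zero, abs_of_nonneg (div_nonneg (hl0 z) hn1.le), le_div_iff₀ hn1]
    exact hz.le
  have hdχ : ∀ z, ‖fderiv ℝ χ z‖ ^ 2 ≤
      4 * M ^ 2 * Real.exp 2 / n ^ 2 * (1 + ‖z‖ ^ 2) ^ (-1 - 1 / n) := fun z => by
    have h1 : HasFDerivAt χ (deriv ψ (l z / n) • (n⁻¹ • fderiv ℝ l z)) z := by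
      have ha := (hψ.differentiable (by simp) (l z / n)).hasDerivAt
      have hb : HasFDerivAt (fun z => l z / n) (n⁻¹ • fderiv ℝ l z) z := by
        simpa [div_eq_mul_inv] using
          (hl.differentiable (by simp) z).hasFDerivAt.mul_const n⁻¹
      exact HasDerivAt.comp_hasFDerivAt (h₂ := ψ) (f := fun z => l z / n) z ha hb
    by_cases hz : 2 * n < l z
    · have h0 : fderiv ℝ χ z = 0 := by
        have : χ =ᶠ[𝓝 z] fun _ => 0 := by
          filter_upwards [hl.continuous.continuousAt.eventually (lt_mem_nhds hz)] with w hw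
          exact hzero w hw
        rw [this.fderiv_eq]; simp
      rw [h0]
      have := hpos z
      simp only [norm_zero, zero_pow two_ne_zero]
      positivity
    -- Where `l ≤ 2 n`, the factor `(1 + |z|²)^(-1/n)` is at least `e⁻²`. Inserting it at the cost
    -- of `e²` makes the majorant integrable over the plane, with integral proportional to `π n`.
    · have hx : Real.exp (-2) ≤ (1 + ‖z‖ ^ 2) ^ (-(1 / n)) := by
        rw [Real.rpow_def_of_pos (hpos z)]
        refine Real.exp_le_exp.2 ?_
        have : l z / n ≤ 2 := by rw [div_le_iff₀ hn1]; linarith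
        change -2 ≤ l z * _
        rw [mul_neg, mul_one_div]
        linarith
      have hx' : 1 ≤ Real.exp 2 * (1 + ‖z‖ ^ 2) ^ (-(1 / n)) := by
        calc (1 : ℝ) = Real.exp 2 * Real.exp (-2) := by rw [← Real.exp_add]; simp
          _ ≤ _ := by gcongr
      rw [h1.fderiv, norm_smul, norm_smul, sub_eq_add_neg, Real.rpow_add (hpos z),
        Real.rpow_neg_one, mul_pow, mul_pow, norm_inv, Real.norm_of_nonneg hn1.le]
      calc ‖deriv ψ (l z / n)‖ ^ 2 * (n⁻¹ ^ 2 * ‖fderiv ℝ l z‖ ^ 2)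
          ≤ M ^ 2 * (n⁻¹ ^ 2 * (4 * (1 + ‖z‖ ^ 2)⁻¹)) := by
            gcongr
            · exact hM _
            · exact hdl z
        _ = (M ^ 2 * (n⁻¹ ^ 2 * (4 * (1 + ‖z‖ ^ 2)⁻¹))) * 1 := by ring
        _ ≤ (M ^ 2 * (n⁻¹ ^ 2 * (4 * (1 + ‖z‖ ^ 2)⁻¹))) *
            (Real.exp 2 * (1 + ‖z‖ ^ 2) ^ (-(1 / n))) := by
            have := hpos z
            gcongr
        _ = _ := by ring
  refine ⟨χ, hχ, ?_, fun z hz => ?_, ?_⟩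
  · refine HasCompactSupport.intro (isCompact_closedBall (0 : ℂ) (Real.exp (2 * n))) fun z hz => ?_
    apply hzero
    rw [mem_closedBall_zero_iff, not_le] at hz
    rw [Real.lt_log_iff_exp_lt (hpos z)]
    have : 1 ≤ Real.exp (2 * n) := Real.one_le_exp (by positivity)
    nlinarith
  · refine ψ.one_of_mem_closedBall ?_
    rw [mem_closedBall_zero_iff, Real.norm_of_nonneg (div_nonneg (hl0 z) hn1.le)]
    refine (div_le_one hn1).2 (le_trans (Real.log_le_log (hpos z) ?_) hnR)
    gcongr
  · obtain ⟨hi, hiv⟩ := integral_one_add_norm_sq_rpow_le (one_div_pos.2 hn1)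
    calc ∫ z, ‖fderiv ℝ χ z‖ ^ 2
        ≤ ∫ z : ℂ, 4 * M ^ 2 * Real.exp 2 / n ^ 2 * (1 + ‖z‖ ^ 2) ^ (-1 - 1 / n) :=
          integral_mono_of_nonneg (Filter.Eventually.of_forall fun z => by positivity)
            (hi.const_mul _) (Filter.Eventually.of_forall hdχ)
      _ = 4 * M ^ 2 * Real.exp 2 * Real.pi / n := by
          rw [integral_const_mul, hiv]
          field_simp
      _ ≤ ε := hnε

/-- If a continuous conformal density `s²` on the plane is the divergence of a vector field that is
bounded with respect to it, it vanishes. -/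
theorem eq_zero_of_sq_eq_divergence {p q s : ℂ → ℝ} {C : ℝ} (hp : ContDiff ℝ 1 p)
    (hq : ContDiff ℝ 1 q) (hs : Continuous s) (hps : ∀ z, |p z| ≤ C * s z)
    (hqs : ∀ z, |q z| ≤ C * s z)
    (hpq : ∀ z, s z ^ 2 = fderiv ℝ p z 1 + fderiv ℝ q z Complex.I) (z₀ : ℂ) : s z₀ = 0 := by
  let B := Metric.closedBall (0 : ℂ) (‖z₀‖ + 1)
  have hle : ∫ z in B, s z ^ 2 ≤ 0 := by
    refine le_of_forall_pos_le_add fun ε hε => ?_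
    -- The `+ 1` keeps the denominator positive when `C = 0`.
    have hδ : 0 < ε / (16 * C ^ 2 + 1) := by positivity
    obtain ⟨χ, hχ, hχc, hχ1, hχε⟩ := exists_cutoff_energy_le (‖z₀‖ + 1) hδ
    have hi : Integrable (fun z => χ z ^ 2 * s z ^ 2) :=
      Continuous.integrable_of_hasCompactSupport (by have := hχ.continuous; fun_prop)
        (hχc.mono fun z hz h0 => hz (by simp [h0]))
    calc ∫ z in B, s z ^ 2 = ∫ z in B, χ z ^ 2 * s z ^ 2 := by
          refine setIntegral_congr_fun Metric.isClosed_closedBall.measurableSet fun z hz => ?_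
          simp only [hχ1 z (mem_closedBall_zero_iff.1 hz), one_pow, one_mul]
      _ ≤ ∫ z, χ z ^ 2 * s z ^ 2 :=
          setIntegral_le_integral hi (Filter.Eventually.of_forall fun z => by positivity)
      _ ≤ 16 * C ^ 2 * ∫ z, ‖fderiv ℝ χ z‖ ^ 2 :=
          integral_cutoff_sq_le hp hq hs hps hqs hpq hχ hχc
      _ ≤ 16 * C ^ 2 * (ε / (16 * C ^ 2 + 1)) := by gcongr
      _ ≤ 0 + ε := by
          rw [zero_add, mul_div_assoc', div_le_iff₀ (by positivity)]
          nlinarith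
  by_contra hne
  have hpos : 0 < ∫ z in B, s z ^ 2 := by
    have hio : IntegrableOn (fun z => s z ^ 2) B :=
      (hs.pow 2).continuousOn.integrableOn_compact (isCompact_closedBall _ _)
    rw [setIntegral_pos_iff_support_of_nonneg_ae
      (Filter.Eventually.of_forall fun z => by positivity) hio]
    have hopen : IsOpen ((Function.support fun z => s z ^ 2) ∩ Metric.ball (0 : ℂ) (‖z₀‖ + 1)) :=
      (hs.pow 2).isOpen_support.inter Metric.isOpen_ball
    refine (hopen.measure_pos volume ⟨z₀, by simpa using hne, by simp⟩).trans_le (measure_mono ?_)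
    exact Set.inter_subset_inter_right _ Metric.ball_subset_closedBall
  exact absurd hle (not_le.2 hpos)

end Parabolicity

/-! ### Pulling back `∂` and `∂̄` of one-forms along holomorphic curves. -/

section FormsAlongCurves

open SKT

variable {F : Type*} [NormedAddCommGroup F] [NormedSpace ℂ F]

/-- A `1`-form on a vector space as a linear functional. -/
noncomputable def oneFormEval : (F [⋀^Fin 1]→L[ℝ] ℂ) →L[ℝ] F →L[ℝ] ℂ :=
  (ContinuousAlternatingMap.ofSubsingletonLIE (𝕜 := ℝ) (E := F) (F := ℂ)
    (0 : Fin 1)).symm.toContinuousLinearEquiv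

theorem oneFormEval_apply (η : F [⋀^Fin 1]→L[ℝ] ℂ) (v : F) : oneFormEval η v = η ![v] := by
  change η (fun _ => v) = η ![v]
  congr 1
  funext i
  fin_cases i
  rfl

theorem alternatizeUncurryFin_one_apply (L : F →L[ℝ] F [⋀^Fin 1]→L[ℝ] ℂ) (v w : F) :
    ContinuousAlternatingMap.alternatizeUncurryFin L ![v, w] =
      oneFormEval (L v) w - oneFormEval (L w) v := by
  rw [ContinuousAlternatingMap.alternatizeUncurryFin_apply, Fin.sum_univ_two]
  have h0 : Fin.removeNth (0 : Fin 2) ![v, w] = ![w] := by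
    funext i; fin_cases i; rfl
  have h1 : Fin.removeNth (1 : Fin 2) ![v, w] = ![v] := by
    funext i; fin_cases i; rfl
  rw [h0, h1]
  simp [oneFormEval_apply, sub_eq_add_neg]

/-- A holomorphic curve only tests a two-form on pairs `(v, i v)`. -/
theorem vDel_apply_I (η : F → F [⋀^Fin 1]→L[ℝ] ℂ) (x v : F) :
    vDel η x ![v, Complex.I • v] =
      1 / 2 * (oneFormEval (fderiv ℝ η x v) (Complex.I • v) -
        Complex.I * oneFormEval (fderiv ℝ η x (Complex.I • v)) (Complex.I • v) -
        oneFormEval (fderiv ℝ η x (Complex.I • v)) v -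
        Complex.I * oneFormEval (fderiv ℝ η x v) v) := by
  unfold vDel
  rw [alternatizeUncurryFin_one_apply]
  simp only [oneFormEval_apply, J, smul_apply, sub_apply, ContinuousLinearMap.comp_apply,
    ContinuousAlternatingMap.smul_apply, ContinuousAlternatingMap.sub_apply,
    ContinuousAlternatingMap.neg_apply, ContinuousLinearMap.id_apply, smul_smul,
    Complex.I_mul_I, neg_smul, one_smul, map_neg, smul_eq_mul]
  ring

theorem vDelbar_apply_I (η : F → F [⋀^Fin 1]→L[ℝ] ℂ) (x v : F) :
    vDelbar η x ![v, Complex.I • v] =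
      1 / 2 * (oneFormEval (fderiv ℝ η x v) (Complex.I • v) +
        Complex.I * oneFormEval (fderiv ℝ η x (Complex.I • v)) (Complex.I • v) -
        oneFormEval (fderiv ℝ η x (Complex.I • v)) v +
        Complex.I * oneFormEval (fderiv ℝ η x v) v) := by
  unfold vDelbar
  rw [alternatizeUncurryFin_one_apply]
  simp only [oneFormEval_apply, J, smul_apply, add_apply, ContinuousLinearMap.comp_apply,
    ContinuousAlternatingMap.smul_apply, ContinuousAlternatingMap.add_apply,
    ContinuousAlternatingMap.neg_apply, ContinuousLinearMap.id_apply, smul_smul,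
    Complex.I_mul_I, neg_smul, one_smul, map_neg, smul_eq_mul]
  ring

variable {Y : Type*} [TopologicalSpace Y] [ChartedSpace F Y]

/-- The value of a `1`-form along a curve on the image of the constant vector field `c`. -/
noncomputable def formAlong (α : Form F Y 1) (f : ℂ → Y) (c t : ℂ) : ℂ :=
  α (f t) ![mfderiv 𝓘(ℂ, ℂ) 𝓘(ℂ, F) f t c]

theorem SKT.Form.IsSmooth.contDiffAt_inChart {α : Form F Y 1} (hα : α.IsSmooth) (y : Y) :
    ContDiffAt ℝ 1 (α.inChart y) (extChartAt 𝓘(ℂ, F) y y) :=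
  ((hα y).of_le (by simp)).contDiffAt (extChartAt_target_mem_nhds y)

variable [IsManifold 𝓘(ℂ, F) ω Y]

/-- With the chart at `f t₀` frozen and `u` the curve read in it, the pulled-back coefficient is `η
(u t) (c u' t)`; its regularity and derivative become vector-space calculus. -/
theorem eventually_formAlong_eq {f : ℂ → Y} (hf : MDifferentiable 𝓘(ℂ, ℂ) 𝓘(ℂ, F) f)
    (α : Form F Y 1) (t₀ c : ℂ) :
    formAlong α f c =ᶠ[𝓝 t₀] fun t =>
      oneFormEval (α.inChart (f t₀) ((extChartAt 𝓘(ℂ, F) (f t₀) ∘ f) t))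
        (c • deriv (extChartAt 𝓘(ℂ, F) (f t₀) ∘ f) t) := by
  have : IsManifold 𝓘(ℂ, F) 1 Y := .of_le (n := ω) (by simp)
  have hopen : IsOpen (f ⁻¹' (chartAt F (f t₀)).source) :=
    (chartAt F (f t₀)).open_source.preimage hf.continuous
  filter_upwards [hopen.mem_nhds (mem_chart_source F (f t₀))] with t ht
  set e := extChartAt 𝓘(ℂ, F) (f t₀)
  have hsrc : ∀ s ∈ f ⁻¹' (chartAt F (f t₀)).source, f s ∈ e.source := fun s hs => by
    rwa [extChartAt_source]
  have hu : HasDerivAt (e ∘ f) (deriv (e ∘ f) t) t :=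
    ((hf.differentiableOn_extChartAt_comp (f t₀)).differentiableAt
      (hopen.mem_nhds ht)).hasDerivAt
  have hsymm : MDifferentiableAt 𝓘(ℂ, F) 𝓘(ℂ, F) e.symm ((e ∘ f) t) := by
    have := mdifferentiableWithinAt_extChartAt_symm (I := 𝓘(ℂ, F)) (e.map_source (hsrc t ht))
    rwa [modelWithCornersSelf_coe, Set.range_id, mdifferentiableWithinAt_univ] at this
  have hcomp := hsymm.hasMFDerivAt.comp t hu.hasFDerivAt.hasMFDerivAt
  have heq : f =ᶠ[𝓝 t] e.symm ∘ (e ∘ f) := by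
    filter_upwards [hopen.mem_nhds ht] with s hs
    exact (e.left_inv (hsrc s hs)).symm
  have hm := (hcomp.congr_of_eventuallyEq heq).mfderiv
  have hy : e.symm ((e ∘ f) t) = f t := e.left_inv (hsrc t ht)
  rw [oneFormEval_apply]
  let α' : Y → F [⋀^Fin 1]→L[ℝ] ℂ := α
  let L : F →L[ℂ] F := mfderiv 𝓘(ℂ, F) 𝓘(ℂ, F) e.symm ((e ∘ f) t)
  have hL : (mfderiv 𝓘(ℂ, ℂ) 𝓘(ℂ, F) f t c : F) = L (c • deriv (e ∘ f) t) := by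
    rw [hm]; rfl
  have h1 : formAlong α f c t = α' (f t) ![(mfderiv 𝓘(ℂ, ℂ) 𝓘(ℂ, F) f t c : F)] := rfl
  have h2 : α.inChart (f t₀) ((e ∘ f) t) ![c • deriv (e ∘ f) t] =
      α' (e.symm ((e ∘ f) t)) ![L (c • deriv (e ∘ f) t)] := by
    change α' (e.symm ((e ∘ f) t)) (L ∘ ![c • deriv (e ∘ f) t]) = _
    congr 1
    funext i
    fin_cases i
    rfl
  rw [h1, h2, hy, hL]

theorem analyticAt_extChartAt_comp [CompleteSpace F] {f : ℂ → Y}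
    (hf : MDifferentiable 𝓘(ℂ, ℂ) 𝓘(ℂ, F) f) (t₀ : ℂ) :
    AnalyticAt ℂ (extChartAt 𝓘(ℂ, F) (f t₀) ∘ f) t₀ :=
  (hf.differentiableOn_extChartAt_comp (f t₀)).analyticAt
    (((chartAt F (f t₀)).open_source.preimage hf.continuous).mem_nhds (mem_chart_source F (f t₀)))

theorem contDiff_formAlong [CompleteSpace F] {f : ℂ → Y}
    (hf : MDifferentiable 𝓘(ℂ, ℂ) 𝓘(ℂ, F) f) {α : Form F Y 1} (hα : α.IsSmooth) (c : ℂ) :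
    ContDiff ℝ 1 (formAlong α f c) := by
  refine contDiff_iff_contDiffAt.2 fun t₀ => ?_
  refine ContDiffAt.congr_of_eventuallyEq ?_ (eventually_formAlong_eq hf α t₀ c)
  have hu := analyticAt_extChartAt_comp hf t₀
  have hu1 : ContDiffAt ℝ 1 (extChartAt 𝓘(ℂ, F) (f t₀) ∘ f) t₀ := hu.contDiffAt.restrict_scalars ℝ
  have hu2 : ContDiffAt ℝ 1 (deriv (extChartAt 𝓘(ℂ, F) (f t₀) ∘ f)) t₀ :=
    hu.deriv.contDiffAt.restrict_scalars ℝ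
  have hE : ContDiff ℝ 1 (oneFormEval (F := F)) := ContinuousLinearMap.contDiff _
  have h1 : ContDiffAt ℝ 1 (fun t => oneFormEval
      (α.inChart (f t₀) ((extChartAt 𝓘(ℂ, F) (f t₀) ∘ f) t))) t₀ :=
    ContDiffAt.comp (g := oneFormEval) t₀ hE.contDiffAt
      (ContDiffAt.comp (f := extChartAt 𝓘(ℂ, F) (f t₀) ∘ f) t₀ (hα.contDiffAt_inChart (f t₀)) hu1)
  exact h1.clm_apply (hu2.const_smul c)

/-- Product rule for `η (u t) (c u' t)`. The `u''` term depends on `c` and `d` only through their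
product, and so cancels in `∂` and `∂̄` by `i² = -1`. -/
theorem fderiv_formAlong [CompleteSpace F] {f : ℂ → Y}
    (hf : MDifferentiable 𝓘(ℂ, ℂ) 𝓘(ℂ, F) f) {α : Form F Y 1} (hα : α.IsSmooth) (t₀ c d : ℂ) :
    fderiv ℝ (formAlong α f c) t₀ d =
      oneFormEval (fderiv ℝ (α.inChart (f t₀)) (extChartAt 𝓘(ℂ, F) (f t₀) (f t₀))
        (d • deriv (extChartAt 𝓘(ℂ, F) (f t₀) ∘ f) t₀))
        (c • deriv (extChartAt 𝓘(ℂ, F) (f t₀) ∘ f) t₀) +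
      oneFormEval (α.inChart (f t₀) (extChartAt 𝓘(ℂ, F) (f t₀) (f t₀)))
        (c • d • deriv (deriv (extChartAt 𝓘(ℂ, F) (f t₀) ∘ f)) t₀) := by
  rw [(eventually_formAlong_eq hf α t₀ c).fderiv_eq]
  have hu := analyticAt_extChartAt_comp hf t₀
  set u := extChartAt 𝓘(ℂ, F) (f t₀) ∘ f
  have hu1 := hu.differentiableAt.hasDerivAt.hasFDerivAt.restrictScalars ℝ
  have hu2 := hu.deriv.differentiableAt.hasDerivAt.hasFDerivAt.restrictScalars ℝ
  have hη := ((hα.contDiffAt_inChart (f t₀)).differentiableAt (by simp)).hasFDerivAt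
  have h1 := oneFormEval.hasFDerivAt.comp t₀ (HasFDerivAt.comp (f := u) t₀ hη hu1)
  have h2 := (h1.clm_apply (hu2.const_smul c)).fderiv
  have h3 := congrArg (fun L : ℂ →L[ℝ] ℂ => L d) h2
  refine Eq.trans h3 ?_
  simp [add_comm]
  rfl

theorem mfderiv_extChartAt_mfderiv {f : ℂ → Y} (hf : MDifferentiable 𝓘(ℂ, ℂ) 𝓘(ℂ, F) f)
    (t c : ℂ) :
    (mfderiv 𝓘(ℂ, F) 𝓘(ℂ, F) (extChartAt 𝓘(ℂ, F) (f t)) (f t)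
      (mfderiv 𝓘(ℂ, ℂ) 𝓘(ℂ, F) f t c) : F) = c • deriv (extChartAt 𝓘(ℂ, F) (f t) ∘ f) t := by
  have : IsManifold 𝓘(ℂ, F) 1 Y := .of_le (n := ω) (by simp)
  have h := mfderiv_comp t
    (mdifferentiableAt_extChartAt (I := 𝓘(ℂ, F)) (mem_chart_source F (f t))) (hf t)
  have h2 := congrArg (fun L : ℂ →L[ℂ] F => L c) h
  have h3 : mfderiv 𝓘(ℂ, ℂ) 𝓘(ℂ, F) (extChartAt 𝓘(ℂ, F) (f t) ∘ f) t =
      fderiv ℂ (extChartAt 𝓘(ℂ, F) (f t) ∘ f) t := mfderiv_eq_fderiv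
  have h4 := congrArg (fun L : ℂ →L[ℂ] F => L c) h3
  exact h2.symm.trans (h4.trans (fderiv_eq_smul_deriv c))

/-- Pullback of `∂α` along a holomorphic curve. -/
theorem del_along_curve [CompleteSpace F] {f : ℂ → Y}
    (hf : MDifferentiable 𝓘(ℂ, ℂ) 𝓘(ℂ, F) f) {α : Form F Y 1} (hα : α.IsSmooth) (t : ℂ) :
    α.del (f t) ![mfderiv 𝓘(ℂ, ℂ) 𝓘(ℂ, F) f t (1 : ℂ),
      mfderiv 𝓘(ℂ, ℂ) 𝓘(ℂ, F) f t Complex.I] =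
    1 / 2 * ((fderiv ℝ (formAlong α f Complex.I) t 1 -
        Complex.I * fderiv ℝ (formAlong α f 1) t 1) -
      Complex.I * (fderiv ℝ (formAlong α f Complex.I) t Complex.I -
        Complex.I * fderiv ℝ (formAlong α f 1) t Complex.I)) := by
  set u' := deriv (extChartAt 𝓘(ℂ, F) (f t) ∘ f) t with hu'
  have h : α.del (f t) ![mfderiv 𝓘(ℂ, ℂ) 𝓘(ℂ, F) f t (1 : ℂ),
      mfderiv 𝓘(ℂ, ℂ) 𝓘(ℂ, F) f t Complex.I] =
      vDel (α.inChart (f t)) (extChartAt 𝓘(ℂ, F) (f t) (f t)) ![u', Complex.I • u'] := by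
    refine congrArg (vDel (α.inChart (f t)) (extChartAt 𝓘(ℂ, F) (f t) (f t))) ?_
    funext i
    fin_cases i
    · exact (mfderiv_extChartAt_mfderiv hf t 1).trans (one_smul ℂ u')
    · exact mfderiv_extChartAt_mfderiv hf t Complex.I
  rw [h, vDel_apply_I]
  simp only [fderiv_formAlong hf hα, ← hu', one_smul, one_mul, smul_smul, Complex.I_mul_I, neg_smul,
    map_neg]
  linear_combination (1 / 2 *
    (oneFormEval (α.inChart (f t) (extChartAt 𝓘(ℂ, F) (f t) (f t)))
      (Complex.I • deriv (deriv (extChartAt 𝓘(ℂ, F) (f t) ∘ f)) t) +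
    oneFormEval (fderiv ℝ (α.inChart (f t)) (extChartAt 𝓘(ℂ, F) (f t) (f t))
      (Complex.I • u')) u')) * (-Complex.I_mul_I)

/-- Pullback of `∂̄α` along a holomorphic curve. -/
theorem delbar_along_curve [CompleteSpace F] {f : ℂ → Y}
    (hf : MDifferentiable 𝓘(ℂ, ℂ) 𝓘(ℂ, F) f) {α : Form F Y 1} (hα : α.IsSmooth) (t : ℂ) :
    α.delbar (f t) ![mfderiv 𝓘(ℂ, ℂ) 𝓘(ℂ, F) f t (1 : ℂ),
      mfderiv 𝓘(ℂ, ℂ) 𝓘(ℂ, F) f t Complex.I] =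
    1 / 2 * ((fderiv ℝ (formAlong α f Complex.I) t 1 +
        Complex.I * fderiv ℝ (formAlong α f 1) t 1) +
      Complex.I * (fderiv ℝ (formAlong α f Complex.I) t Complex.I +
        Complex.I * fderiv ℝ (formAlong α f 1) t Complex.I)) := by
  set u' := deriv (extChartAt 𝓘(ℂ, F) (f t) ∘ f) t with hu'
  have h : α.delbar (f t) ![mfderiv 𝓘(ℂ, ℂ) 𝓘(ℂ, F) f t (1 : ℂ),
      mfderiv 𝓘(ℂ, ℂ) 𝓘(ℂ, F) f t Complex.I] =
      vDelbar (α.inChart (f t)) (extChartAt 𝓘(ℂ, F) (f t) (f t)) ![u', Complex.I • u'] := by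
    refine congrArg (vDelbar (α.inChart (f t)) (extChartAt 𝓘(ℂ, F) (f t) (f t))) ?_
    funext i
    fin_cases i
    · exact (mfderiv_extChartAt_mfderiv hf t 1).trans (one_smul ℂ u')
    · exact mfderiv_extChartAt_mfderiv hf t Complex.I
  rw [h, vDelbar_apply_I]
  simp only [fderiv_formAlong hf hα, ← hu', one_smul, one_mul, smul_smul, Complex.I_mul_I, neg_smul,
    map_neg]
  linear_combination (1 / 2 *
    (oneFormEval (α.inChart (f t) (extChartAt 𝓘(ℂ, F) (f t) (f t)))
      (Complex.I • deriv (deriv (extChartAt 𝓘(ℂ, F) (f t) ∘ f)) t) +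
    oneFormEval (fderiv ℝ (α.inChart (f t)) (extChartAt 𝓘(ℂ, F) (f t) (f t))
      (Complex.I • u')) u')) * (-Complex.I_mul_I)

end FormsAlongCurves

/-! ### SKT hyperbolic metrics exclude nonconstant entire curves. -/

section SKTHyperbolic

open SKT

universe u v

variable {F : Type v} [NormedAddCommGroup F] [NormedSpace ℂ F]
  {X : Type u} [TopologicalSpace X] [ChartedSpace F X]

/-- Holomorphic entire curves lift to the universal cover. -/
theorem SKT.IsUniversalCover.exists_lift_entire {Y : Type u} [TopologicalSpace Y]
    [ChartedSpace F Y] {π : Y → X} (hπ : IsUniversalCover F π) {f : ℂ → X}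
    (hf : MDifferentiable 𝓘(ℂ, ℂ) 𝓘(ℂ, F) f) :
    ∃ g : ℂ → Y, MDifferentiable 𝓘(ℂ, ℂ) 𝓘(ℂ, F) g ∧ ∀ t, π (g t) = f t := by
  obtain ⟨y, hy⟩ := hπ.surjective (f 0)
  -- The continuous lift exists since `ℂ` is simply connected. Near each point it is a holomorphic
  -- local inverse of `π` composed with `f`.
  obtain ⟨g, ⟨-, hg⟩, -⟩ := hπ.isCoveringMap.existsUnique_continuousMap_lifts
    ⟨f, hf.continuous⟩ 0 y hy
  have hg' : ∀ t, π (g t) = f t := fun t => congrFun hg t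
  refine ⟨g, fun t => ?_, hg'⟩
  have hloc := hπ.isLocalBiholomorphism (g t)
  have h1 := hloc.localInverse_mdifferentiableAt (by simp)
  rw [hg'] at h1
  refine (h1.comp t (hf t)).congr_of_eventuallyEq ?_
  filter_upwards [g.continuous.continuousAt.eventually hloc.localInverse_eventuallyEq_left]
    with s hs
  have hs' : hloc.localInverse (π (g s)) = g s := hs
  rw [Function.comp_apply, ← hg', hs']

theorem SKT.IsHermitianMetric.apply_I_nonneg {h : Form F X 2} (hh : IsHermitianMetric h) {x : X}
    (v : TangentSpace 𝓘(ℂ, F) x) : 0 ≤ (h x ![v, Complex.I • v]).re := by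
  by_cases hv : v = 0
  · have : h x ![v, Complex.I • v] = 0 := (h x).map_coord_zero 0 (by simp [hv])
    simp [this]
  · exact (hh.pos x v hv).le

/-- Lets one density `s` control a holomorphic curve in both directions `1` and `i`. -/
theorem SKT.IsHermitianMetric.hnorm_I_smul {h : Form F X 2} (hh : IsHermitianMetric h) {x : X}
    (v : TangentSpace 𝓘(ℂ, F) x) : hnorm h (Complex.I • v) = hnorm h v := by
  unfold hnorm
  rw [hh.type_one_one]

theorem pullback_apply_I {Y : Type u} [TopologicalSpace Y] [ChartedSpace F Y] (h : Form F X 2)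
    (π : Y → X) {y : Y} (v : TangentSpace 𝓘(ℂ, F) y) :
    h.pullback π y ![v, Complex.I • v] =
      h (π y) ![mfderiv 𝓘(ℂ, F) 𝓘(ℂ, F) π y v,
        Complex.I • mfderiv 𝓘(ℂ, F) 𝓘(ℂ, F) π y v] := by
  refine congrArg (h (π y)) ?_
  funext i
  fin_cases i
  · rfl
  · exact map_smul (mfderiv 𝓘(ℂ, F) 𝓘(ℂ, F) π y) Complex.I v

theorem hnorm_pullback {Y : Type u} [TopologicalSpace Y] [ChartedSpace F Y] (h : Form F X 2)
    (π : Y → X) {y : Y} (v : TangentSpace 𝓘(ℂ, F) y) :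
    hnorm (h.pullback π) v = hnorm h (mfderiv 𝓘(ℂ, F) 𝓘(ℂ, F) π y v) := by
  unfold hnorm
  rw [pullback_apply_I]

theorem norm_formAlong_le {Y : Type u} [TopologicalSpace Y] [ChartedSpace F Y] {h : Form F Y 2}
    {η : Form F Y 1} {C : ℝ} (hC : ∀ (y : Y) (v : Fin 1 → TangentSpace 𝓘(ℂ, F) y),
      ‖η y v‖ ≤ C * ∏ i, hnorm h (v i)) (f : ℂ → Y) (c t : ℂ) :
    ‖formAlong η f c t‖ ≤ C * hnorm h (mfderiv 𝓘(ℂ, ℂ) 𝓘(ℂ, F) f t c) := by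
  have := hC (f t) ![mfderiv 𝓘(ℂ, ℂ) 𝓘(ℂ, F) f t c]
  simpa [formAlong] using this

/-- A complex manifold with an SKT hyperbolic metric contains no nonconstant entire curves. -/
theorem SKT.IsSKTHyperbolicMetric.mfderiv_entire_eq_zero [CompleteSpace F] {h : Form F X 2}
    (hh : IsSKTHyperbolicMetric h) {f : ℂ → X} (hf : MDifferentiable 𝓘(ℂ, ℂ) 𝓘(ℂ, F) f) (t₀ : ℂ) :
    mfderiv 𝓘(ℂ, ℂ) 𝓘(ℂ, F) f t₀ (1 : ℂ) = 0 := by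
  obtain ⟨Y, _, _, π, hπ, α, β, hα, hβ, ⟨A, hA⟩, ⟨B, hB⟩, heq⟩ := hh.tildeBounded
  have hm := hh.isHermitianMetric
  have := hπ.isManifold
  obtain ⟨g, hg, hgf⟩ := hπ.exists_lift_entire hf
  have hπd : MDifferentiable 𝓘(ℂ, F) 𝓘(ℂ, F) π := hπ.isLocalBiholomorphism.mdifferentiable (by simp)
  let w : ∀ t, TangentSpace 𝓘(ℂ, F) (g t) := fun t => mfderiv 𝓘(ℂ, ℂ) 𝓘(ℂ, F) g t (1 : ℂ)
  have hwI : ∀ t, mfderiv 𝓘(ℂ, ℂ) 𝓘(ℂ, F) g t Complex.I = Complex.I • w t := fun t => by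
    have h1 := congrArg (mfderiv 𝓘(ℂ, ℂ) 𝓘(ℂ, F) g t) (mul_one Complex.I).symm
    exact h1.trans (map_smul (mfderiv 𝓘(ℂ, ℂ) 𝓘(ℂ, F) g t) Complex.I (1 : ℂ))
  let s : ℂ → ℝ := fun t => hnorm (h.pullback π) (w t)
  have hs0 : ∀ t, 0 ≤ s t := fun t => Real.sqrt_nonneg _
  have hsI : ∀ t, hnorm (h.pullback π) (mfderiv 𝓘(ℂ, ℂ) 𝓘(ℂ, F) g t Complex.I) = s t := fun t => by
    simp only [s]
    rw [hwI, hnorm_pullback, hnorm_pullback, map_smul, hm.hnorm_I_smul]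
  have hs2 : ∀ t, s t ^ 2 = (h.pullback π (g t) ![w t, Complex.I • w t]).re := fun t => by
    refine Real.sq_sqrt ?_
    rw [pullback_apply_I]
    exact hm.apply_I_nonneg _
  let a := formAlong α g
  let b := formAlong β g
  have ha : ∀ c, ContDiff ℝ 1 (a c) := contDiff_formAlong hg hα
  have hb : ∀ c, ContDiff ℝ 1 (b c) := contDiff_formAlong hg hβ
  -- Collecting the `x`- and `y`-derivatives in the curve formulas for `∂α` and `∂̄β` shows that `∂α
  -- + ∂̄β`, evaluated on `(w, i w)`, is `∂P/∂x + ∂Q/∂y`.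
  let P : ℂ → ℂ := fun t => 2⁻¹ * (a Complex.I t - Complex.I * a 1 t + b Complex.I t +
    Complex.I * b 1 t)
  let Q : ℂ → ℂ := fun t => 2⁻¹ * (-(Complex.I * a Complex.I t) - a 1 t +
    Complex.I * b Complex.I t - b 1 t)
  have hP : ContDiff ℝ 1 P := by
    have h1 := ha 1; have h2 := ha Complex.I; have h3 := hb 1; have h4 := hb Complex.I
    fun_prop
  have hQ : ContDiff ℝ 1 Q := by
    have h1 := ha 1; have h2 := ha Complex.I; have h3 := hb 1; have h4 := hb Complex.I
    fun_prop
  have da : ∀ c t, HasFDerivAt (a c) (fderiv ℝ (a c) t) t := fun c t =>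
    ((ha c).differentiable (by simp) t).hasFDerivAt
  have db : ∀ c t, HasFDerivAt (b c) (fderiv ℝ (b c) t) t := fun c t =>
    ((hb c).differentiable (by simp) t).hasFDerivAt
  have key : ∀ t, h.pullback π (g t) ![w t, Complex.I • w t] =
      fderiv ℝ P t 1 + fderiv ℝ Q t Complex.I := fun t => by
    have dP : fderiv ℝ P t = (2⁻¹ : ℂ) • (fderiv ℝ (a Complex.I) t -
        Complex.I • fderiv ℝ (a 1) t + fderiv ℝ (b Complex.I) t +
        Complex.I • fderiv ℝ (b 1) t) :=
      (((((da Complex.I t).sub ((da 1 t).const_mul Complex.I)).add (db Complex.I t)).add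
        ((db 1 t).const_mul Complex.I)).const_mul (2⁻¹ : ℂ)).fderiv
    have dQ : fderiv ℝ Q t = (2⁻¹ : ℂ) • (-(Complex.I • fderiv ℝ (a Complex.I) t) -
        fderiv ℝ (a 1) t + Complex.I • fderiv ℝ (b Complex.I) t - fderiv ℝ (b 1) t) :=
      ((((((da Complex.I t).const_mul Complex.I).neg).sub (da 1 t)).add
        ((db Complex.I t).const_mul Complex.I)).sub (db 1 t) |>.const_mul (2⁻¹ : ℂ)).fderiv
    have e1 := del_along_curve hg hα t
    have e2 := delbar_along_curve hg hβ t
    have e3 : h.pullback π (g t) ![w t, Complex.I • w t] =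
        α.del (g t) ![w t, Complex.I • w t] + β.delbar (g t) ![w t, Complex.I • w t] := by
      rw [heq]; rfl
    rw [hwI] at e1 e2
    rw [e3]
    refine (congrArg₂ (· + ·) e1 e2).trans ?_
    rw [dP, dQ]
    simp only [smul_apply, add_apply, sub_apply, neg_apply, smul_eq_mul, a, b]
    linear_combination (1 / 2 * (fderiv ℝ (formAlong α g 1) t Complex.I +
      fderiv ℝ (formAlong β g 1) t Complex.I)) * Complex.I_mul_I
  have hre : ∀ {R : ℂ → ℂ}, ContDiff ℝ 1 R → ∀ t c,
      fderiv ℝ (fun t => (R t).re) t c = (fderiv ℝ R t c).re := fun {R} hR t c => by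
    have := (Complex.reCLM.hasFDerivAt.comp t
      ((hR.differentiable (by simp) t).hasFDerivAt)).fderiv
    exact congrArg (fun L : ℂ →L[ℝ] ℝ => L c) this
  have hp : ContDiff ℝ 1 (fun t => (P t).re) := Complex.reCLM.contDiff.comp hP
  have hq : ContDiff ℝ 1 (fun t => (Q t).re) := Complex.reCLM.contDiff.comp hQ
  have hpq : ∀ t, s t ^ 2 = fderiv ℝ (fun t => (P t).re) t 1 +
      fderiv ℝ (fun t => (Q t).re) t Complex.I := fun t => by
    rw [hs2, key, hre hP, hre hQ, Complex.add_re]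
  -- Continuity is read off from the divergence formula, since `P` and `Q` are `C¹`.
  have hsc : Continuous s := by
    have : s = fun t => Real.sqrt (fderiv ℝ (fun t => (P t).re) t 1 +
        fderiv ℝ (fun t => (Q t).re) t Complex.I) := by
      funext t
      rw [← hpq, Real.sqrt_sq (hs0 t)]
    rw [this]
    have c1 := hp.continuous_fderiv (by simp)
    have c2 := hq.continuous_fderiv (by simp)
    fun_prop
  have ba1 : ∀ t, ‖a 1 t‖ ≤ A * s t := fun t => norm_formAlong_le hA g 1 t
  have bb1 : ∀ t, ‖b 1 t‖ ≤ B * s t := fun t => norm_formAlong_le hB g 1 t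
  have baI : ∀ t, ‖a Complex.I t‖ ≤ A * s t := fun t => by
    rw [← hsI]; exact norm_formAlong_le hA g Complex.I t
  have bbI : ∀ t, ‖b Complex.I t‖ ≤ B * s t := fun t => by
    rw [← hsI]; exact norm_formAlong_le hB g Complex.I t
  -- Two terms come from `α` and two from `β`, each with a unit coefficient; halving their sum gives
  -- the constant `A + B`.
  have bound : ∀ {x₁ x₂ x₃ x₄ z : ℂ} {t : ℝ}, ‖x₁‖ ≤ A * t → ‖x₂‖ ≤ A * t → ‖x₃‖ ≤ B * t →
      ‖x₄‖ ≤ B * t → z = (x₁ + x₂ + x₃ + x₄) / 2 → |z.re| ≤ (A + B) * t := by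
    intro x₁ x₂ x₃ x₄ z t h1 h2 h3 h4 hz
    refine (Complex.abs_re_le_norm z).trans ?_
    rw [hz, norm_div, Complex.norm_ofNat]
    have := norm_add₄_le (a := x₁) (b := x₂) (c := x₃) (d := x₄)
    linarith
  have hps : ∀ t, |(P t).re| ≤ (A + B) * s t := fun t =>
    bound (baI t) (x₂ := -(Complex.I * a 1 t)) (by simpa using ba1 t) (bbI t)
      (x₄ := Complex.I * b 1 t) (by simpa using bb1 t) (by simp only [P]; ring)
  have hqs : ∀ t, |(Q t).re| ≤ (A + B) * s t := fun t =>
    bound (x₁ := -(Complex.I * a Complex.I t)) (by simpa using baI t) (x₂ := -a 1 t)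
      (by simpa using ba1 t) (x₃ := Complex.I * b Complex.I t) (by simpa using bbI t)
      (x₄ := -b 1 t) (by simpa using bb1 t) (by simp only [Q]; ring)
  have hs : s t₀ = 0 := eq_zero_of_sq_eq_divergence hp hq hsc hps hqs hpq t₀
  have hcomp : (mfderiv 𝓘(ℂ, F) 𝓘(ℂ, F) π (g t₀) (w t₀) : F) =
      mfderiv 𝓘(ℂ, ℂ) 𝓘(ℂ, F) f t₀ (1 : ℂ) := by
    have e : f = π ∘ g := by funext t; exact (hgf t).symm
    rw [e, mfderiv_comp t₀ (hπd _) (hg _)]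
    rfl
  rw [← hcomp]
  by_contra hne
  have hpos := hm.pos (π (g t₀)) (mfderiv 𝓘(ℂ, F) 𝓘(ℂ, F) π (g t₀) (w t₀)) hne
  have : 0 < s t₀ := by
    simp only [s]
    rw [hnorm_pullback]
    exact Real.sqrt_pos.2 hpos
  exact this.ne' hs

end SKTHyperbolic

theorem proposition3p7
    {E : Type*} [NormedAddCommGroup E] [NormedSpace ℂ E] [FiniteDimensional ℂ E]
    {F : Type*} [NormedAddCommGroup F] [NormedSpace ℂ F] [FiniteDimensional ℂ F]
    -- a complex Lie group `G` and a closed subgroup `Γ`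
    {G : Type*} [Group G] [TopologicalSpace G] [T2Space G] [ChartedSpace E G]
    [LieGroup 𝓘(ℂ, E) ω G]
    (Γ : Subgroup G) (hΓ : IsClosed (Γ : Set G))
    -- the complex manifold structure of `G ⧸ Γ`, for which `G → G ⧸ Γ` is a holomorphic submersion
    [ChartedSpace F (G ⧸ Γ)] [IsManifold 𝓘(ℂ, F) ω (G ⧸ Γ)]
    (hπ : MDifferentiable 𝓘(ℂ, E) 𝓘(ℂ, F) (fun g : G => (g : G ⧸ Γ)))
    (hπ' : ∀ g : G, Function.Surjective
      (mfderiv 𝓘(ℂ, E) 𝓘(ℂ, F) (fun g : G => (g : G ⧸ Γ)) g))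
    -- `G ⧸ Γ` is compact, connected and not reduced to a point
    [CompactSpace (G ⧸ Γ)] [ConnectedSpace (G ⧸ Γ)] [Nontrivial (G ⧸ Γ)] :
    (¬ ∃ h : SKT.Form F (G ⧸ Γ) 2, SKT.IsSKTHyperbolicMetric h) ∧
    ¬ SKT.IsKobayashiHyperbolic F (G ⧸ Γ) ∧
    -- each tangent vector is the velocity of an orbit of a one-parameter complex subgroup
    (∀ ξ : TangentBundle 𝓘(ℂ, F) (G ⧸ Γ), ∃ φ : ℂ → G,
      MDifferentiable 𝓘(ℂ, ℂ) 𝓘(ℂ, E) φ ∧ (∀ s t : ℂ, φ (s + t) = φ s * φ t) ∧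
      (⟨φ 0 • ξ.1, mfderiv 𝓘(ℂ, ℂ) 𝓘(ℂ, F) (fun t : ℂ => φ t • ξ.1) 0 (1 : ℂ)⟩ :
        TangentBundle 𝓘(ℂ, F) (G ⧸ Γ)) = ξ) ∧
    (∀ ξ : TangentBundle 𝓘(ℂ, F) (G ⧸ Γ), SKT.kobayashiRoyden ξ = 0) ∧
    ∀ p q : G ⧸ Γ, SKT.kobayashiDist F p q = 0 := by
  have : CompleteSpace E := FiniteDimensional.complete ℂ E
  have : CompleteSpace F := FiniteDimensional.complete ℂ F
  have horbit := exists_oneParameter_orbit hπ hπ'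
  have hdist := kobayashiDist_quotient_eq_zero hπ
  refine ⟨?_, fun hK => ?_, horbit, fun ξ => ?_, hdist⟩
  · rintro ⟨h, hh⟩
    -- Each tangent vector is the velocity of an entire orbit, hence zero, so the model space is
    -- trivial. Chart domains are then single points.
    have hF : Subsingleton F := by
      refine subsingleton_of_forall_eq 0 fun v => ?_
      obtain ⟨p⟩ : Nonempty (G ⧸ Γ) := inferInstance
      obtain ⟨φ, hφ, -, hv⟩ := horbit (⟨p, v⟩ : TangentBundle 𝓘(ℂ, F) (G ⧸ Γ))
      have h0 := hh.mfderiv_entire_eq_zero (mdifferentiable_smul_quotient hπ hφ p) 0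
      have h1 : (v : F) = mfderiv 𝓘(ℂ, ℂ) 𝓘(ℂ, F) (fun t : ℂ => φ t • p) 0 (1 : ℂ) :=
        (congrArg (fun ζ : TangentBundle 𝓘(ℂ, F) (G ⧸ Γ) => (ζ.2 : F)) hv).symm
      rw [h1]
      exact h0
    have hdisc : DiscreteTopology (G ⧸ Γ) := by
      refine discreteTopology_iff_isOpen_singleton.2 fun p => ?_
      convert (chartAt F p).open_source
      ext q
      refine ⟨fun hq => hq ▸ mem_chart_source F p, fun hq => ?_⟩
      exact (chartAt F p).injOn hq (mem_chart_source F p) (Subsingleton.elim _ _)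
    have := PreconnectedSpace.trivial_of_discrete (X := G ⧸ Γ)
    exact not_subsingleton (G ⧸ Γ) this
  · obtain ⟨p, q, hpq⟩ := exists_pair_ne (G ⧸ Γ)
    exact hpq (hK p q (hdist p q))
  · obtain ⟨φ, hφ, -, hξ⟩ := horbit ξ
    exact kobayashiRoyden_eq_zero_of_entire (mdifferentiable_smul_quotient hπ hφ ξ.1) hξ
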